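/- Write $\log_1 x=\log x$ and $\log_{j+1}x=\log(\log_j x)$, let $\gamma$ be Euler's constant and $\zeta$ the Riemann zeta function. For every fixed $\theta<1$ there are constants $C$ and $T_0$, depending only on $\theta$, such that for all real $T\ge T_0$ and, uniformly, for all real $A$ with $10\le A\le(\log T)^{\theta}$, the set of points $t\in[0,T]$ such that $$|\zeta(1+it)|\ \ge\ e^{\gamma}\bigl(\log_2T+\log_3T-\log_4T-\log A-C\bigr)$$ has Lebesgue measure at least $T^{1-1/A}$. (In particular, with an absolute constant $C$, this holds for each fixed $A\ge10$ and all $T$ sufficiently large in terms of $A$.) -/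

import Mathlib

/-- The `j`-th iterated (natural) logarithm: `log₁ x = log x`, `log_{j+1} x = log (log_j x)`. -/
noncomputable def iterLog (j : ℕ) (x : ℝ) : ℝ := Real.log^[j] x

/-- The set of `t ∈ [0, T]` with
`|ζ(1 + it)| ≥ e^γ (log₂ T + log₃ T - log₄ T - log A - C)`. -/
noncomputable def largeZetaSet (T A C : ℝ) : Set ℝ :=
  {t : ℝ | t ∈ Set.Icc 0 T ∧
    Real.exp Real.eulerMascheroniConstant *
        (iterLog 2 T + iterLog 3 T - iterLog 4 T - Real.log A - C)
      ≤ ‖riemannZeta (1 + (t : ℂ) * Complex.I)‖}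

open Filter Topology MeasureTheory Set

/-! This is the resonance method with a completely multiplicative resonator `R(t) = ∑ r(a) a^(it)`,
where `r ≥ 0` is summable. The weight `1 - t/T` on `[0, T]` has nonnegative cosine transform
(`integral_one_sub_div_mul_cos_nonneg`), so off-diagonal terms with nonnegative coefficients may be
discarded, however long `R` is. Since `r(nb) = r(n) r(b)`, the series `R(t) n^(-it) - r(n) R(t)` has
nonnegative coefficients. Hence the weighted integral of `|R|² Re ∑_{n ≤ M} n^(-1-it)` is at least
`∑_{n ≤ M} r(n)/n` times that of `|R|²` (`sum_mul_integral_le_integral_mul_re_sum`), and the latter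
is at least `T/2`.

For `1 ≤ t ≤ T ≤ M` the partial sum is within `6` of `ζ(1+it)`. If `∑ r(n)/n ≥ V + 7`, the surplus
must therefore come from `[0, 1]` and from the points with `|ζ(1+it)| ≥ V`. There the integrand is
at most `R(0)² (1 + log M)`, which bounds the measure from below
(`half_le_mul_measureReal_largeValues`).

The resonator has `r(p) = 1 - p/X` for `p < X` and `r(p) = 0` beyond
(`exists_resonator_coefficients`). Then `log R(0) = ∑_{p<X} log(X/p) = O(X / log X)`, while `∑
r(n)/n` loses only `O(1)` against the Mertens product, which is at least `e^γ (log X - O(1))`.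
Taking `X` to be a small constant times `(log T / A) log₂ T` gives `R(0)² ≤ T^(1/(4A))` and `log X ≥
log₂ T + log₃ T - log A - O(1)`; the term `- log₄ T` is pure slack.

The Mertens product is needed with a bounded error after the factor `log X`, that is, with error
`O(1/log N)` in logarithmic form. This follows from Mertens' first theorem by comparison with the
Euler product of `ζ(1+δ)` at `δ = 1/log N`; the primes below and above `N` produce two exponential
integrals whose difference is `γ`. -/

/-! ### Mertens' first theorem -/

theorem summable_log_div_mul_sub_one :
    Summable fun n : ℕ ↦ Real.log n / (n * (n - 1)) := by
  have h : Summable fun n : ℕ ↦ 4 * (1 / (n : ℝ) ^ (3 / 2 : ℝ)) :=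
    (Real.summable_one_div_nat_rpow.2 (by norm_num)).mul_left 4
  refine Summable.of_nonneg_of_le (fun n ↦ ?_) (fun n ↦ ?_) h
  · rcases Nat.lt_or_ge n 2 with hn | hn
    · interval_cases n <;> simp
    · have : (2 : ℝ) ≤ n := by exact_mod_cast hn
      exact div_nonneg (Real.log_nonneg (by linarith)) (mul_nonneg (by linarith) (by linarith))
  · rcases Nat.lt_or_ge n 2 with hn | hn
    · interval_cases n <;> simp
    · have h2 : (2 : ℝ) ≤ n := by exact_mod_cast hn
      have hn0 : (0 : ℝ) < n := by linarith
      have hl : Real.log n ≤ 2 * (n : ℝ) ^ (1 / 2 : ℝ) := by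
        have := Real.log_le_rpow_div (ε := 1 / 2) hn0.le (by norm_num)
        linarith
      have hpow : (n : ℝ) ^ (3 / 2 : ℝ) * (n : ℝ) ^ (1 / 2 : ℝ) = (n : ℝ) * n := by
        rw [← Real.rpow_add hn0]; norm_num; ring
      rw [mul_one_div, div_le_div_iff₀ (mul_pos hn0 (by linarith)) (by positivity)]
      have := Real.rpow_nonneg hn0.le (3 / 2 : ℝ)
      have := mul_le_mul_of_nonneg_right hl this
      nlinarith

theorem log_factorial_eq_sum_primesLE (N : ℕ) :
    Real.log N.factorial =
      ∑ p ∈ Nat.primesLE N, (N.factorial.factorization p : ℝ) * Real.log p := by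
  conv_lhs => rw [← Nat.prod_factorization_pow_eq_self N.factorial_ne_zero]
  rw [Finsupp.prod, Nat.cast_prod, Real.log_prod]
  · refine Finset.sum_subset_zero_on_sdiff ?_ ?_ ?_
    · intro p hp
      have hp' := Nat.prime_of_mem_primeFactors hp
      rw [Nat.mem_primesLE]
      exact ⟨(hp'.dvd_factorial).1 (Nat.dvd_of_mem_primeFactors hp), hp'⟩
    · intro p hp
      have : N.factorial.factorization p = 0 := by
        exact Finsupp.notMem_support_iff.1 (Finset.mem_sdiff.1 hp).2
      simp [this]
    · intro p _
      simp
  · intro p hp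
    have := (Nat.prime_of_mem_primeFactors hp).pos
    positivity

/-- Mertens' first theorem. -/
theorem exists_abs_sum_log_prime_div_sub_log_le :
    ∃ K : ℝ, 0 ≤ K ∧ ∀ N : ℕ, 1 ≤ N →
      |∑ p ∈ Nat.primesLE N, Real.log p / p - Real.log N| ≤ K := by
  have hs := summable_log_div_mul_sub_one
  have hnn : ∀ n : ℕ, 0 ≤ Real.log n / (n * ((n : ℝ) - 1)) := fun n ↦ by
    rcases Nat.lt_or_ge n 1 with hn | hn
    · interval_cases n; simp
    · have : (1 : ℝ) ≤ n := by exact_mod_cast hn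
      exact div_nonneg (Real.log_nonneg (by linarith)) (mul_nonneg (by linarith) (by linarith))
  set S := ∑' n : ℕ, Real.log n / (n * ((n : ℝ) - 1)) with hS
  have hS0 : 0 ≤ S := tsum_nonneg hnn
  have hl4 : 0 ≤ Real.log 4 := Real.log_nonneg (by norm_num)
  refine ⟨S + Real.log 4 + 1, by linarith, fun N hN ↦ ?_⟩
  have hN0 : (0 : ℝ) < N := by exact_mod_cast hN
  have hfac := log_factorial_eq_sum_primesLE N
  have hlow : N * Real.log N - N ≤ Real.log N.factorial := by
    have h := Stirling.le_log_factorial_stirling (n := N) (by omega)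
    have h1 : 0 ≤ Real.log N := Real.log_nonneg (by exact_mod_cast hN)
    have h2 : 0 ≤ Real.log (2 * Real.pi) := Real.log_nonneg (by linarith [Real.pi_gt_three])
    linarith
  have hupp : Real.log N.factorial ≤ N * Real.log N := by
    rw [← Real.log_pow]
    refine Real.log_le_log (by exact_mod_cast N.factorial_pos) ?_
    exact_mod_cast N.factorial_le_pow
  -- The exponent of `p` in `N!` is at most `N/(p-1)`, and `1/(p-1) = 1/p + 1/(p(p-1))`; the second
  -- term sums to at most `S`.
  have hu : Real.log N.factorial ≤ N * (∑ p ∈ Nat.primesLE N, Real.log p / p + S) := by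
    have h1 : ∑ p ∈ Nat.primesLE N, Real.log p / (p * ((p : ℝ) - 1)) ≤ S :=
      hs.sum_le_tsum _ (fun n _ ↦ hnn n)
    refine le_trans ?_ (mul_le_mul_of_nonneg_left (add_le_add_right h1 _) hN0.le)
    rw [hfac, ← Finset.sum_add_distrib, Finset.mul_sum]
    refine Finset.sum_le_sum fun p hp ↦ ?_
    have hp' := Nat.prime_of_mem_primesLE hp
    have hp2 : (2 : ℝ) ≤ p := by exact_mod_cast hp'.two_le
    have hlp : 0 ≤ Real.log p := Real.log_nonneg (by linarith)
    have hf : (N.factorial.factorization p : ℝ) ≤ N / ((p : ℝ) - 1) := by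
      have h := Nat.factorization_factorial_le_div_pred hp' N
      have : ((N / (p - 1) : ℕ) : ℝ) ≤ (N : ℝ) / ((p - 1 : ℕ) : ℝ) := Nat.cast_div_le
      rw [Nat.cast_sub hp'.one_le, Nat.cast_one] at this
      exact le_trans (by exact_mod_cast h) this
    calc _ ≤ N / ((p : ℝ) - 1) * Real.log p := by gcongr
      _ = _ := by
        have : (p : ℝ) - 1 ≠ 0 := by linarith
        field_simp; ring
  -- The exponent of `p` is at least `⌊N/p⌋ ≥ N/p - 1`, and the loss of `1` per prime adds up to
  -- `θ(N) ≤ N log 4`.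
  have hl : N * (∑ p ∈ Nat.primesLE N, Real.log p / p) - Real.log 4 * N ≤
      Real.log N.factorial := by
    have h1 : Chebyshev.theta N ≤ Real.log 4 * N := Chebyshev.theta_le_log4_mul_x hN0.le
    rw [Chebyshev.theta_eq_sum_primesLE_log] at h1
    refine le_trans (sub_le_sub_left h1 _) ?_
    rw [hfac, Finset.mul_sum, ← Finset.sum_sub_distrib]
    refine Finset.sum_le_sum fun p hp ↦ ?_
    have hp' := Nat.prime_of_mem_primesLE hp
    have hp2 : (2 : ℝ) ≤ p := by exact_mod_cast hp'.two_le
    have hlp : 0 ≤ Real.log p := Real.log_nonneg (by linarith)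
    have hf : N / p ≤ N.factorial.factorization p := by
      have h1 := Nat.factorization_factorial_mul hp' (n := N / p)
      have h2 := (Nat.factorization_le_iff_dvd (Nat.factorial_ne_zero _)
        N.factorial_ne_zero).2 (Nat.factorial_dvd_factorial (Nat.mul_div_le N p)) p
      omega
    have hf' : (N : ℝ) / p - 1 ≤ N.factorial.factorization p := by
      have h2 : (N : ℝ) / p < (N / p : ℕ) + 1 := by
        rw [div_lt_iff₀ (by linarith)]
        rw [mul_comm]
        exact_mod_cast Nat.lt_mul_div_succ N hp'.pos
      have h3 : ((N / p : ℕ) : ℝ) ≤ N.factorial.factorization p := by exact_mod_cast hf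
      linarith
    calc _ = (N / p - 1) * Real.log p := by ring
      _ ≤ _ := by gcongr
  rw [abs_le]
  constructor
  · have := hlow.trans hu
    have : N * (Real.log N - 1) ≤ N * (∑ p ∈ Nat.primesLE N, Real.log p / p + S) := by linarith
    have := le_of_mul_le_mul_left this hN0
    linarith
  · have := hl.trans hupp
    have : N * (∑ p ∈ Nat.primesLE N, Real.log p / p - Real.log 4) ≤ N * Real.log N := by linarith
    have := le_of_mul_le_mul_left this hN0
    linarith

/-! ### Euler's constant as a difference of exponential integrals -/

theorem integrableOn_log_mul_exp_neg :
    IntegrableOn (fun v : ℝ ↦ Real.log v * Real.exp (-v)) (Ioi 0) := by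
  have h : MellinConvergent (fun t : ℝ ↦ Real.log t • (Real.exp (-t) : ℂ)) 1 := by
    refine (mellin_hasDerivAt_of_isBigO_rpow (E := ℂ) (a := 2) (b := 0) ?_ ?_ ?_ ?_ ?_).1
    · refine (Continuous.continuousOn ?_).locallyIntegrableOn measurableSet_Ioi
      fun_prop
    · rw [← Asymptotics.isBigO_norm_left]
      simp_rw [Complex.norm_real, Asymptotics.isBigO_norm_left]
      simpa only [neg_one_mul] using (isLittleO_exp_neg_mul_rpow_atTop zero_lt_one _).isBigO
    · simp
    · simp_rw [neg_zero, Real.rpow_zero]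
      refine Asymptotics.isBigO_const_of_tendsto (?_ : Tendsto _ _ (𝓝 (1 : ℂ))) one_ne_zero
      rw [(by simp : (1 : ℂ) = Real.exp (-0))]
      exact (Continuous.continuousWithinAt (by fun_prop))
    · simp
  rw [MellinConvergent] at h
  refine IntegrableOn.congr_fun (Integrable.re h) (fun v hv ↦ ?_) measurableSet_Ioi
  simp [-Complex.ofReal_neg, -Complex.ofReal_exp, ← Complex.ofReal_mul]

/-- Differentiating the Gamma integral under the integral sign at `s = 1` gives `Γ'(1) = -γ`. -/
theorem integral_log_mul_exp_neg :
    ∫ v in Ioi (0 : ℝ), Real.log v * Real.exp (-v) = -Real.eulerMascheroniConstant := by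
  have h1 := Complex.hasDerivAt_GammaIntegral (s := 1) (by simp)
  have h2 : HasDerivAt Complex.Gamma
      (∫ t : ℝ in Ioi 0, (t : ℂ) ^ ((1 : ℂ) - 1) * (Real.log t * Real.exp (-t))) 1 := by
    refine h1.congr_of_eventuallyEq ?_
    have : ∀ᶠ s : ℂ in 𝓝 1, 0 < s.re :=
      (Complex.continuous_re.isOpen_preimage _ isOpen_Ioi).mem_nhds (by simp)
    filter_upwards [this] with s hs using Complex.Gamma_eq_integral hs
  have h3 := h2.unique Complex.hasDerivAt_Gamma_one
  have h4 : (∫ t : ℝ in Ioi 0, (t : ℂ) ^ ((1 : ℂ) - 1) * (Real.log t * Real.exp (-t))) =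
      ((∫ v in Ioi (0 : ℝ), Real.log v * Real.exp (-v) : ℝ) : ℂ) := by
    rw [← integral_complex_ofReal]
    simp
  rw [h4] at h3
  exact_mod_cast h3

/-- Integration by parts: `log v * e^(-v)` vanishes both at `1` and at infinity. -/
theorem integral_Ioi_one_exp_neg_div :
    IntegrableOn (fun v : ℝ ↦ Real.exp (-v) / v) (Ioi 1) ∧
    ∫ v in Ioi (1 : ℝ), Real.exp (-v) / v = ∫ v in Ioi (1 : ℝ), Real.log v * Real.exp (-v) := by
  have hint := integrableOn_log_mul_exp_neg.mono_set (Ioi_subset_Ioi (zero_le_one' ℝ))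
  have hexp : IntegrableOn (fun v : ℝ ↦ Real.exp (-v)) (Ioi 1) := integrableOn_exp_neg_Ioi 1
  have hdiv : IntegrableOn (fun v : ℝ ↦ Real.exp (-v) / v) (Ioi 1) := by
    refine Integrable.mono hexp ?_ ?_
    · refine ContinuousOn.aestronglyMeasurable ?_ measurableSet_Ioi
      exact ContinuousOn.div (by fun_prop) (by fun_prop) fun v hv ↦ (zero_lt_one.trans hv).ne'
    · refine (ae_restrict_iff' measurableSet_Ioi).2 (.of_forall fun v (hv : 1 < v) ↦ ?_)
      rw [norm_div, Real.norm_of_nonneg (by linarith : 0 ≤ v)]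
      exact div_le_self (norm_nonneg _) hv.le
  refine ⟨hdiv, ?_⟩
  have h := integral_Ioi_of_hasDerivAt_of_tendsto' (a := 1) (m := 0)
    (f := fun v : ℝ ↦ Real.log v * Real.exp (-v))
    (f' := fun v : ℝ ↦ Real.exp (-v) / v - Real.log v * Real.exp (-v)) ?_ (hdiv.sub hint) ?_
  · rw [integral_sub hdiv hint] at h
    simp at h
    linarith
  · intro v hv
    have hv0 : v ≠ 0 := (zero_lt_one.trans_le hv).ne'
    refine ((Real.hasDerivAt_log hv0).mul ((hasDerivAt_neg v).exp)).congr_deriv ?_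
    ring
  · have h0 := Real.tendsto_pow_mul_exp_neg_atTop_nhds_zero 1
    refine squeeze_zero' (g := fun v : ℝ ↦ v ^ 1 * Real.exp (-v)) ?_ ?_ h0
    · filter_upwards [eventually_ge_atTop 1] with v hv
      have := Real.log_nonneg hv
      positivity
    · filter_upwards [eventually_ge_atTop 1] with v hv
      have := Real.log_le_self (zero_le_one.trans hv)
      rw [pow_one]
      gcongr

theorem one_sub_exp_neg_div_le_one {v : ℝ} (hv : 0 < v) : (1 - Real.exp (-v)) / v ≤ 1 := by
  rw [div_le_one hv]
  linarith [Real.add_one_le_exp (-v)]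

theorem one_sub_exp_neg_div_nonneg {v : ℝ} (hv : 0 ≤ v) : 0 ≤ (1 - Real.exp (-v)) / v :=
  div_nonneg (by linarith [Real.exp_le_one_iff.2 (neg_nonpos.2 hv)]) hv

/-- The quotient is the slope of the chord of `exp` between `-v` and `0`, so convexity gives
monotonicity. -/
theorem antitoneOn_one_sub_exp_neg_div :
    AntitoneOn (fun v : ℝ ↦ (1 - Real.exp (-v)) / v) (Ioi 0) := by
  intro a ha b hb hab
  have ha : 0 < a := ha
  have hb : 0 < b := hb
  have h := convexOn_exp.2 (mem_univ (-b)) (mem_univ 0) (show 0 ≤ a / b by positivity)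
    (show 0 ≤ 1 - a / b by rw [sub_nonneg, div_le_one hb]; exact hab) (by ring)
  simp only [smul_eq_mul, mul_zero, add_zero, Real.exp_zero, mul_one] at h
  rw [show a / b * -b = -a by field_simp] at h
  simp only
  rw [div_le_div_iff₀ hb ha]
  have : b * Real.exp (-a) ≤ b * (a / b * Real.exp (-b) + (1 - a / b)) := by gcongr
  rw [show b * (a / b * Real.exp (-b) + (1 - a / b)) = a * Real.exp (-b) + b - a by field_simp; ring] at this
  linarith

theorem intervalIntegrable_one_sub_exp_neg_div {a b : ℝ} (ha : 0 ≤ a) (hb : 0 ≤ b) :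
    IntervalIntegrable (fun v : ℝ ↦ (1 - Real.exp (-v)) / v) volume a b := by
  refine IntervalIntegrable.mono_fun (g := fun v : ℝ ↦ (1 - Real.exp (-v)) / v) (f := fun _ ↦ (1 : ℝ)) (by simp) ?_ ?_
  · exact (Measurable.aestronglyMeasurable (by fun_prop))
  · refine (ae_restrict_iff' measurableSet_uIoc).2 (.of_forall fun v hv ↦ ?_)
    have hv : 0 < v := (le_min ha hb).trans_lt hv.1
    simp only
    rw [Real.norm_of_nonneg (one_sub_exp_neg_div_nonneg hv.le)]
    simpa using one_sub_exp_neg_div_le_one hv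

theorem integral_zero_one_one_sub_exp_neg_div :
    ∫ v in (0 : ℝ)..1, (1 - Real.exp (-v)) / v =
      -∫ v in (0 : ℝ)..1, Real.log v * Real.exp (-v) := by
  have hint : IntervalIntegrable (fun v : ℝ ↦ Real.log v * Real.exp (-v)) volume 0 1 :=
    (intervalIntegrable_iff_integrableOn_Ioc_of_le zero_le_one).2
      (integrableOn_log_mul_exp_neg.mono_set Ioc_subset_Ioi_self)
  have hdiv := intervalIntegrable_one_sub_exp_neg_div le_rfl zero_le_one
  have h := intervalIntegral.integral_eq_sub_of_hasDerivAt_of_le (zero_le_one' ℝ)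
    (f := fun v : ℝ ↦ (1 - Real.exp (-v)) * Real.log v)
    (f' := fun v : ℝ ↦ Real.log v * Real.exp (-v) + (1 - Real.exp (-v)) / v) ?_ ?_ (hint.add hdiv)
  · rw [intervalIntegral.integral_add hint hdiv] at h
    simp at h
    linarith
  · intro v hv
    rcases hv.1.eq_or_lt with rfl | hv0
    -- At `0` the convention `log 0 = 0` gives the value `0`. It is also the limit, because `|1 -
    -- e^(-v)| ≤ 2|v|` and `v log v → 0`.
    · refine ContinuousAt.continuousWithinAt ?_
      rw [ContinuousAt]
      simp only [neg_zero, Real.exp_zero, sub_self, Real.log_zero, mul_zero]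
      have h0 : Tendsto (fun v : ℝ ↦ 2 * |v * Real.log v|) (𝓝 0) (𝓝 0) := by
        have := (Real.continuous_mul_log.tendsto 0).abs.const_mul 2
        simpa using this
      refine squeeze_zero_norm' ?_ h0
      filter_upwards [Icc_mem_nhds (by norm_num : (-1 : ℝ) < 0) (by norm_num : (0 : ℝ) < 1)] with v hv
      rw [norm_mul, abs_mul, ← mul_assoc, Real.norm_eq_abs, Real.norm_eq_abs]
      gcongr
      rw [abs_sub_comm]
      simpa using Real.abs_exp_sub_one_le (x := -v) (by rw [abs_neg]; exact abs_le.2 hv)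
    · exact ContinuousAt.continuousWithinAt (by
        have := hv0.ne'
        fun_prop (disch := assumption))
  · intro v hv
    have hv0 : v ≠ 0 := hv.1.ne'
    refine ((((hasDerivAt_neg v).exp).const_sub 1).mul (Real.hasDerivAt_log hv0)).congr_deriv ?_
    ring

theorem integral_exp_eq_eulerMascheroniConstant :
    (∫ v in (0 : ℝ)..1, (1 - Real.exp (-v)) / v) - ∫ v in Ioi (1 : ℝ), Real.exp (-v) / v =
      Real.eulerMascheroniConstant := by
  rw [integral_zero_one_one_sub_exp_neg_div, integral_Ioi_one_exp_neg_div.2,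
    intervalIntegral.integral_of_le zero_le_one]
  have h := integral_log_mul_exp_neg
  rw [← Ioc_union_Ioi_eq_Ioi (zero_le_one' ℝ), setIntegral_union (Ioc_disjoint_Ioi le_rfl)
    measurableSet_Ioi (integrableOn_log_mul_exp_neg.mono_set Ioc_subset_Ioi_self)
    (integrableOn_log_mul_exp_neg.mono_set (Ioi_subset_Ioi (zero_le_one' ℝ)))] at h
  linarith

/-! ### The lower bound in Mertens' third theorem -/

/-- Abel summation in one-sided form; it transfers the bounded error of Mertens' first theorem to
sums with decreasing weights. -/
theorem sum_Ico_mul_le_of_antitone {c g : ℕ → ℝ} {B : ℝ} {m n : ℕ}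
    (hB : ∀ k, m ≤ k → ∑ i ∈ Finset.Ico m k, c i ≤ B)
    (hg : ∀ i, m ≤ i → g (i + 1) ≤ g i) (hg0 : ∀ i, m ≤ i → 0 ≤ g i) (hmn : m ≤ n) :
    ∑ i ∈ Finset.Ico m n, c i * g i ≤ B * g m := by
  have hB0 : 0 ≤ B := by simpa using hB m le_rfl
  -- The induction has to keep the unused budget `B - ∑ c i`, valued at the current weight `g n`.
  have key : ∀ n, m ≤ n → ∑ i ∈ Finset.Ico m (n + 1), c i * g i ≤
      B * g m + (∑ i ∈ Finset.Ico m (n + 1), c i - B) * g n := by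
    intro n hn
    induction n, hn using Nat.le_induction with
    | base => simp; ring_nf; rfl
    | succ k hk ih =>
      rw [Finset.sum_Ico_succ_top (by omega), Finset.sum_Ico_succ_top (b := k + 1) (by omega)]
      have h1 := hB (k + 1) (by omega)
      nlinarith [hg k hk]
  rcases hmn.eq_or_lt with rfl | h
  · simpa using mul_nonneg hB0 (hg0 m le_rfl)
  · obtain ⟨k, rfl⟩ : ∃ k, n = k + 1 := ⟨n - 1, by omega⟩
    have h1 := hB (k + 1) (by omega)
    have h2 := key k (by omega)
    nlinarith [hg0 k (by omega)]

/-- The summand `log p / p` of Mertens' first theorem, as a function on all naturals. -/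
noncomputable def primeLogDiv (n : ℕ) : ℝ := if n.Prime then Real.log n / n else 0

theorem sum_primesLE_eq_sum_Ico {f : ℕ → ℝ} (N : ℕ) :
    ∑ p ∈ Nat.primesLE N, f p = ∑ n ∈ Finset.Ico 2 (N + 1), if n.Prime then f n else 0 := by
  rw [Nat.primesLE_eq_filter_Icc_two, Finset.sum_filter]
  rfl

/-- Backward increments of `log` serve the upper bound and forward ones the lower bound: these are
the directions in which a Riemann sum of a decreasing function compares with its integral. -/
theorem exists_sum_primeLogDiv_bounds :
    ∃ K : ℝ, 0 ≤ K ∧ ∀ m k : ℕ, 2 ≤ m → m ≤ k →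
      ∑ n ∈ Finset.Ico m k, (primeLogDiv n - (Real.log n - Real.log (n - 1 : ℕ))) ≤ K ∧
      ∑ n ∈ Finset.Ico m k, (Real.log (n + 1 : ℕ) - Real.log n - primeLogDiv n) ≤ K := by
  obtain ⟨K, hK0, hK⟩ := exists_abs_sum_log_prime_div_sub_log_le
  refine ⟨2 * K + 1, by linarith, fun m k hm hmk ↦ ?_⟩
  obtain ⟨m, rfl⟩ : ∃ j, m = j + 1 := ⟨m - 1, by omega⟩
  obtain ⟨k, rfl⟩ : ∃ j, k = j + 1 := ⟨k - 1, by omega⟩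
  have h1 := abs_le.1 (hK m (by omega))
  have h2 := abs_le.1 (hK k (by omega))
  have hsum : ∑ n ∈ Finset.Ico (m + 1) (k + 1), primeLogDiv n =
      ∑ p ∈ Nat.primesLE k, Real.log p / p - ∑ p ∈ Nat.primesLE m, Real.log p / p := by
    rw [sum_primesLE_eq_sum_Ico, sum_primesLE_eq_sum_Ico,
      ← Finset.sum_Ico_consecutive _ (show 2 ≤ m + 1 by omega) (show m + 1 ≤ k + 1 by omega)]
    simp [primeLogDiv]
  have hA : ∑ n ∈ Finset.Ico (m + 1) (k + 1), (Real.log n - Real.log (n - 1 : ℕ)) =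
      Real.log k - Real.log m := by
    rw [← Finset.sum_Ico_add']
    exact Finset.sum_Ico_sub (fun n : ℕ ↦ Real.log n) (by omega)
  have hB : ∑ n ∈ Finset.Ico (m + 1) (k + 1), (Real.log (n + 1 : ℕ) - Real.log n) =
      Real.log (k + 1 : ℕ) - Real.log (m + 1 : ℕ) :=
    Finset.sum_Ico_sub (fun n : ℕ ↦ Real.log n) hmk
  have hm1 : Real.log m ≤ Real.log (m + 1 : ℕ) :=
    Real.log_le_log (by exact_mod_cast (by omega : 0 < m)) (by push_cast; linarith)
  have hk1 : Real.log (k + 1 : ℕ) ≤ Real.log k + 1 := by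
    have hk : (1 : ℝ) ≤ k := by exact_mod_cast (by omega : 1 ≤ k)
    have : Real.log (k + 1 : ℕ) ≤ Real.log (k * Real.exp 1) := by
      refine Real.log_le_log (by positivity) ?_
      push_cast
      nlinarith [Real.add_one_le_exp 1]
    rwa [Real.log_mul (by positivity) (Real.exp_pos 1).ne', Real.log_exp] at this
  constructor
  · rw [Finset.sum_sub_distrib, hsum, hA]; linarith
  · rw [Finset.sum_sub_distrib, hsum, hB]; linarith

theorem sub_le_log_one_sub_sub {y z : ℝ} (hz : 0 ≤ z) (hzy : z ≤ y) (hy : y < 1) :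
    y - z ≤ -Real.log (1 - y) - -Real.log (1 - z) := by
  have h := Real.one_sub_inv_le_log_of_pos (x := (1 - z) / (1 - y)) (div_pos (by linarith) (by linarith))
  rw [Real.log_div (by linarith) (by linarith), inv_div] at h
  have : y - z ≤ 1 - (1 - y) / (1 - z) := by
    rw [one_sub_div (by linarith), le_div_iff₀ (by linarith)]
    nlinarith
  linarith

theorem neg_log_one_sub_le {y : ℝ} (hy0 : 0 ≤ y) (hy : y ≤ 1 / 2) :
    -Real.log (1 - y) ≤ y + 2 * y ^ 2 := by
  have h := Real.one_sub_inv_le_log_of_pos (x := 1 - y) (by linarith)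
  have : (1 - y)⁻¹ ≤ 1 + y + 2 * y ^ 2 := by
    rw [inv_le_iff_one_le_mul₀ (by linarith)]
    nlinarith [mul_nonneg hy0 (mul_nonneg hy0 (by linarith : 0 ≤ 1 - 2 * y))]
  linarith

theorem sum_Ico_one_div_sq_le {m n : ℕ} (hm : 1 ≤ m) (hmn : m ≤ n) :
    ∑ i ∈ Finset.Ico (m + 1) (n + 1), 1 / (i : ℝ) ^ 2 ≤ 1 / (m : ℝ) := by
  have h : ∑ i ∈ Finset.Ico (m + 1) (n + 1), 1 / (i : ℝ) ^ 2 ≤ 1 / (m : ℝ) - 1 / n := by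
    induction n, hmn using Nat.le_induction with
    | base => simp
    | succ k hk ih =>
      rw [Finset.sum_Ico_succ_top (by omega)]
      have hk0 : (1 : ℝ) ≤ k := by exact_mod_cast hm.trans hk
      have : 1 / ((k + 1 : ℕ) : ℝ) ^ 2 ≤ 1 / (k : ℝ) - 1 / ((k + 1 : ℕ) : ℝ) := by
        push_cast
        rw [div_sub_div _ _ (by positivity) (by positivity), div_le_div_iff₀ (by positivity) (by positivity)]
        nlinarith
      linarith
  have : 0 ≤ 1 / (n : ℝ) := by positivity
  linarith

/-- The real Dirichlet monomial `n ↦ n ^ (-s)` as a completely multiplicative function. -/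
noncomputable def natRpowNeg (s : ℝ) (hs : s ≠ 0) : ℕ →*₀ ℝ where
  toFun n := (n : ℝ) ^ (-s)
  map_zero' := by simp [Real.zero_rpow (neg_ne_zero.2 hs)]
  map_one' := by simp
  map_mul' m n := by simp [Real.mul_rpow]

/-- Telescoping form of the integral test: each term dominates the corresponding decrement of
`n^(-(s-1))/(s-1)`. -/
theorem one_div_sub_one_le_tsum_rpow {s : ℝ} (hs : 1 < s) :
    1 / (s - 1) ≤ ∑' n : ℕ, (n : ℝ) ^ (-s) := by
  have hsum : Summable fun n : ℕ ↦ (n : ℝ) ^ (-s) := Real.summable_nat_rpow.2 (by linarith)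
  have ha : 0 < s - 1 := by linarith
  have hstep : ∀ n : ℕ, 1 ≤ n →
      (n : ℝ) ^ (-(s - 1)) - ((n + 1 : ℕ) : ℝ) ^ (-(s - 1)) ≤ (s - 1) * (n : ℝ) ^ (-s) := by
    intro n hn
    have hn0 : (0 : ℝ) < n := by exact_mod_cast hn
    have h1 : ((n + 1 : ℕ) : ℝ) = n * (1 + 1 / n) := by push_cast; field_simp
    have h2 : 1 - (s - 1) / n ≤ (1 + 1 / (n : ℝ)) ^ (-(s - 1)) := by
      rw [Real.rpow_def_of_pos (by positivity)]
      refine le_trans ?_ (Real.add_one_le_exp _)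
      have := Real.log_le_sub_one_of_pos (show 0 < 1 + 1 / (n : ℝ) by positivity)
      have := mul_le_mul_of_nonneg_right this ha.le
      rw [show (1 + 1 / (n : ℝ) - 1) * (s - 1) = (s - 1) / n by ring] at this
      linarith
    have h3 : (n : ℝ) ^ (-s) = (n : ℝ) ^ (-(s - 1)) / n := by
      rw [← Real.rpow_sub_one hn0.ne']; ring_nf
    rw [h1, Real.mul_rpow hn0.le (by positivity), h3]
    have h4 := mul_le_mul_of_nonneg_left h2 (Real.rpow_nonneg hn0.le (-(s - 1)))
    calc _ ≤ (n : ℝ) ^ (-(s - 1)) - (n : ℝ) ^ (-(s - 1)) * (1 - (s - 1) / n) := by linarith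
      _ = _ := by ring
  have hpart : ∀ N : ℕ, 1 ≤ N →
      1 - (N : ℝ) ^ (-(s - 1)) ≤ (s - 1) * ∑' n : ℕ, (n : ℝ) ^ (-s) := by
    intro N hN
    have h1 := Finset.sum_Ico_sub (fun n : ℕ ↦ -((n : ℝ) ^ (-(s - 1)))) hN
    simp only [Nat.cast_one, Real.one_rpow] at h1
    calc _ = ∑ n ∈ Finset.Ico 1 N, (-((n + 1 : ℕ) : ℝ) ^ (-(s - 1)) - -(n : ℝ) ^ (-(s - 1))) := by
          rw [h1]; ring
      _ ≤ ∑ n ∈ Finset.Ico 1 N, (s - 1) * (n : ℝ) ^ (-s) := by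
          refine Finset.sum_le_sum fun n hn ↦ ?_
          have := hstep n (Finset.mem_Ico.1 hn).1
          linarith
      _ ≤ _ := by
          rw [← Finset.mul_sum]
          refine mul_le_mul_of_nonneg_left (hsum.sum_le_tsum _ fun n _ ↦ ?_) ha.le
          positivity
  have hlim : Tendsto (fun N : ℕ ↦ 1 - (N : ℝ) ^ (-(s - 1))) atTop (𝓝 (1 - 0)) :=
    ((tendsto_rpow_neg_atTop ha).comp tendsto_natCast_atTop_atTop).const_sub 1
  have := le_of_tendsto hlim ((eventually_ge_atTop 1).mono hpart)
  rw [div_le_iff₀ ha]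
  linarith

/-- The full Euler product is `ζ(1+δ) ≥ 1/δ`; the loss `ε` pays for stopping at a finite `M`, so
that only finite sums over primes occur later. -/
theorem exists_log_le_sum_neg_log {δ : ℝ} (hδ : 0 < δ) {ε : ℝ} (hε : 0 < ε) (N : ℕ) :
    ∃ M, N ≤ M ∧ Real.log (1 / δ) - ε ≤
      ∑ p ∈ Nat.primesLE M, -Real.log (1 - (p : ℝ) ^ (-(1 + δ))) := by
  have hs : 1 + δ ≠ 0 := by positivity
  have hsum : Summable fun n : ℕ ↦ ‖natRpowNeg (1 + δ) hs n‖ :=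
    (Real.summable_nat_rpow.2 (by linarith)).norm
  have h := EulerProduct.eulerProduct_completely_multiplicative hsum
  have hZ : Real.exp (Real.log (1 / δ) - ε) < ∑' n : ℕ, natRpowNeg (1 + δ) hs n := by
    have := one_div_sub_one_le_tsum_rpow (s := 1 + δ) (by linarith)
    refine lt_of_lt_of_le ?_ this
    rw [add_sub_cancel_left]
    have h1 : Real.exp (Real.log (1 / δ)) = 1 / δ := Real.exp_log (by positivity)
    nth_rewrite 2 [← h1]
    exact Real.exp_lt_exp.2 (by linarith)
  obtain ⟨M, hM, hNM⟩ := ((h.eventually_const_le hZ).and (eventually_ge_atTop (N + 1))).exists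
  refine ⟨M - 1, by omega, ?_⟩
  rw [← Nat.primesBelow_eq_primesLE_sub_one]
  have hp : ∀ p ∈ Nat.primesBelow M, 0 < 1 - (p : ℝ) ^ (-(1 + δ)) := by
    intro p hp
    have hp1 : (1 : ℝ) < p := by exact_mod_cast (Nat.prime_of_mem_primesBelow hp).one_lt
    have := Real.rpow_lt_one_of_one_lt_of_neg hp1 (by linarith : -(1 + δ) < 0)
    linarith
  have h2 := Real.log_le_log (Real.exp_pos _) hM
  rw [Real.log_exp, Real.log_prod] at h2
  · refine h2.trans_eq (Finset.sum_congr rfl fun p _ ↦ ?_)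
    rw [Real.log_inv]; rfl
  · intro p h'
    exact inv_ne_zero (hp p h').ne'

theorem antitoneOn_exp_neg_div : AntitoneOn (fun v : ℝ ↦ Real.exp (-v) / v) (Ioi 0) := by
  intro a ha b hb hab
  have ha : 0 < a := ha
  simp only
  gcongr

/-- Written this way, the sum over primes is a Riemann sum in `v = δ log p` against the weights `log
p / p` of Mertens' first theorem. -/
theorem inv_sub_rpow_eq {δ : ℝ} (hδ : δ ≠ 0) {p : ℕ} (hp : p.Prime) :
    (p : ℝ)⁻¹ - (p : ℝ) ^ (-(1 + δ)) =
      Real.log p / p * (δ * ((1 - Real.exp (-(δ * Real.log p))) / (δ * Real.log p))) := by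
  have hp0 : (0 : ℝ) < p := by exact_mod_cast hp.pos
  have hl : Real.log p ≠ 0 := (Real.log_pos (by exact_mod_cast hp.one_lt)).ne'
  rw [neg_add, Real.rpow_add hp0, Real.rpow_neg_one, Real.rpow_def_of_pos hp0,
    show Real.log p * -δ = -(δ * Real.log p) by ring]
  field_simp

theorem rpow_eq_log_div_mul {δ : ℝ} (hδ : δ ≠ 0) {p : ℕ} (hp : p.Prime) :
    (p : ℝ) ^ (-(1 + δ)) =
      Real.log p / p * (δ * (Real.exp (-(δ * Real.log p)) / (δ * Real.log p))) := by
  have hp0 : (0 : ℝ) < p := by exact_mod_cast hp.pos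
  have hl : Real.log p ≠ 0 := (Real.log_pos (by exact_mod_cast hp.one_lt)).ne'
  rw [neg_add, Real.rpow_add hp0, Real.rpow_neg_one, Real.rpow_def_of_pos hp0,
    show Real.log p * -δ = -(δ * Real.log p) by ring]
  field_simp

theorem sum_log_step_mul_ge_integral {f : ℝ → ℝ} (hf : AntitoneOn f (Ioi 0)) {δ : ℝ} (hδ : 0 < δ)
    {m n : ℕ} (hm : 2 ≤ m) (hmn : m ≤ n) :
    ∫ v in (δ * Real.log m)..(δ * Real.log n), f v ≤
      ∑ i ∈ Finset.Ico m n, (Real.log (i + 1 : ℕ) - Real.log i) * (δ * f (δ * Real.log i)) := by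
  have hpos : ∀ i : ℕ, 2 ≤ i → 0 < δ * Real.log i := fun i hi ↦
    mul_pos hδ (Real.log_pos (by exact_mod_cast hi))
  have hmono : ∀ i : ℕ, 2 ≤ i → δ * Real.log i ≤ δ * Real.log (i + 1 : ℕ) := fun i hi ↦ by
    gcongr; omega
  have hII : ∀ i : ℕ, 2 ≤ i →
      IntervalIntegrable f volume (δ * Real.log i) (δ * Real.log (i + 1 : ℕ)) := fun i hi ↦ by
    refine AntitoneOn.intervalIntegrable (hf.mono ?_)
    rw [uIcc_of_le (hmono i hi)]
    exact fun v hv ↦ (hpos i hi).trans_le hv.1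
  have h := intervalIntegral.sum_integral_adjacent_intervals_Ico (f := f) (μ := volume)
    (a := fun i : ℕ ↦ δ * Real.log i) hmn (fun k hk ↦ hII k (hm.trans hk.1))
  rw [← h]
  refine Finset.sum_le_sum fun i hi ↦ ?_
  have hi2 : 2 ≤ i := hm.trans (Finset.mem_Ico.1 hi).1
  calc _ ≤ ∫ _ in (δ * Real.log i)..(δ * Real.log (i + 1 : ℕ)), f (δ * Real.log i) := by
        refine intervalIntegral.integral_mono_on (hmono i hi2) (hII i hi2) (by simp) fun v hv ↦ ?_
        exact hf (hpos i hi2) ((hpos i hi2).trans_le hv.1) hv.1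
    _ = _ := by rw [intervalIntegral.integral_const, smul_eq_mul]; ring

theorem sum_log_step_mul_le_integral {f : ℝ → ℝ} (hf : AntitoneOn f (Ioi 0)) {δ : ℝ} (hδ : 0 < δ)
    {m n : ℕ} (hm : 2 ≤ m) (hmn : m ≤ n) :
    ∑ i ∈ Finset.Ico (m + 1) (n + 1),
      (Real.log i - Real.log (i - 1 : ℕ)) * (δ * f (δ * Real.log i)) ≤
    ∫ v in (δ * Real.log m)..(δ * Real.log n), f v := by
  have hpos : ∀ i : ℕ, 2 ≤ i → 0 < δ * Real.log i := fun i hi ↦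
    mul_pos hδ (Real.log_pos (by exact_mod_cast hi))
  have hmono : ∀ i : ℕ, 2 ≤ i → δ * Real.log i ≤ δ * Real.log (i + 1 : ℕ) := fun i hi ↦ by
    gcongr; omega
  have hII : ∀ i : ℕ, 2 ≤ i →
      IntervalIntegrable f volume (δ * Real.log i) (δ * Real.log (i + 1 : ℕ)) := fun i hi ↦ by
    refine AntitoneOn.intervalIntegrable (hf.mono ?_)
    rw [uIcc_of_le (hmono i hi)]
    exact fun v hv ↦ (hpos i hi).trans_le hv.1
  have h := intervalIntegral.sum_integral_adjacent_intervals_Ico (f := f) (μ := volume)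
    (a := fun i : ℕ ↦ δ * Real.log i) hmn (fun k hk ↦ hII k (hm.trans hk.1))
  rw [← h, ← Finset.sum_Ico_add']
  refine Finset.sum_le_sum fun i hi ↦ ?_
  have hi2 : 2 ≤ i := hm.trans (Finset.mem_Ico.1 hi).1
  calc _ = ∫ _ in (δ * Real.log i)..(δ * Real.log (i + 1 : ℕ)), f (δ * Real.log (i + 1 : ℕ)) := by
        rw [intervalIntegral.integral_const, smul_eq_mul, Nat.add_sub_cancel]; ring
    _ ≤ _ := by
        refine intervalIntegral.integral_mono_on (hmono i hi2) (by simp) (hII i hi2) fun v hv ↦ ?_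
        exact hf ((hpos i hi2).trans_le hv.1) (hpos (i + 1) (by omega)) hv.2

/-- Logarithmic form of the lower bound in Mertens' third theorem. -/
theorem exists_sum_neg_log_one_sub_inv_ge :
    ∃ C : ℝ, 0 ≤ C ∧ ∀ N : ℕ, 2 ≤ N →
      Real.log (Real.log N) + Real.eulerMascheroniConstant - C / Real.log N ≤
        ∑ p ∈ Nat.primesLE N, -Real.log (1 - (p : ℝ)⁻¹) := by
  obtain ⟨K, hK0, hK⟩ := exists_sum_primeLogDiv_bounds
  -- In units of `δ`: `K + 1` comes from the primes up to `N`, `K` from the primes beyond, `2` from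
  -- the higher-order terms of the logarithm, and `1` from truncating the Euler product.
  refine ⟨2 * K + 4, by linarith, fun N hN ↦ ?_⟩
  have hN2 : (2 : ℝ) ≤ N := by exact_mod_cast hN
  have hL : 0 < Real.log N := Real.log_pos (by linarith)
  -- With this `δ` the cut `p = N` falls at `v = 1` in the variable `v = δ log p`.
  set δ := 1 / Real.log N with hδ_def
  have hδ : 0 < δ := by positivity
  have hδL : δ * Real.log N = 1 := by rw [hδ_def]; field_simp
  have hpos : ∀ i : ℕ, 2 ≤ i → 0 < δ * Real.log i := fun i hi ↦
    mul_pos hδ (Real.log_pos (by exact_mod_cast hi))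
  obtain ⟨M, hNM, hM⟩ := exists_log_le_sum_neg_log hδ hδ N
  have hsplit : ∑ p ∈ Nat.primesLE M, -Real.log (1 - (p : ℝ) ^ (-(1 + δ))) =
      ∑ p ∈ Nat.primesLE N, -Real.log (1 - (p : ℝ) ^ (-(1 + δ))) +
      ∑ n ∈ Finset.Ico (N + 1) (M + 1),
        if n.Prime then -Real.log (1 - (n : ℝ) ^ (-(1 + δ))) else 0 := by
    rw [sum_primesLE_eq_sum_Ico, sum_primesLE_eq_sum_Ico,
      Finset.sum_Ico_consecutive _ (by omega) (by omega)]
  have hmono : ∀ i : ℕ, 2 ≤ i → δ * Real.log i ≤ δ * Real.log (i + 1 : ℕ) := fun i hi ↦ by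
    gcongr; omega
  -- Primes up to `N`: replacing `p^(-1-δ)` by `1/p` gains the first exponential integral. Starting
  -- at `δ log 2` instead of `0` costs at most `δ`, as the integrand is at most `1`.
  have hsmall : (∫ v in (0 : ℝ)..1, (1 - Real.exp (-v)) / v) - δ * (K + 1) ≤
      ∑ p ∈ Nat.primesLE N, ((p : ℝ)⁻¹ - (p : ℝ) ^ (-(1 + δ))) := by
    set F : ℝ → ℝ := fun v ↦ (1 - Real.exp (-v)) / v with hF
    have h1 : ∑ p ∈ Nat.primesLE N, ((p : ℝ)⁻¹ - (p : ℝ) ^ (-(1 + δ))) =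
        ∑ n ∈ Finset.Ico 2 (N + 1), primeLogDiv n * (δ * F (δ * Real.log n)) := by
      rw [sum_primesLE_eq_sum_Ico]
      refine Finset.sum_congr rfl fun n _ ↦ ?_
      by_cases hn : n.Prime
      · rw [if_pos hn, primeLogDiv, if_pos hn, inv_sub_rpow_eq hδ.ne' hn]
      · simp [primeLogDiv, hn]
    have h2 := sum_log_step_mul_ge_integral (f := F) antitoneOn_one_sub_exp_neg_div hδ le_rfl
      (show 2 ≤ N + 1 by omega)
    have h3 := sum_Ico_mul_le_of_antitone (m := 2) (n := N + 1)
      (g := fun n : ℕ ↦ δ * F (δ * Real.log n)) (fun k hk ↦ (hK 2 k le_rfl hk).2)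
      (fun i hi ↦ mul_le_mul_of_nonneg_left (antitoneOn_one_sub_exp_neg_div (hpos i hi)
        (hpos (i + 1) (by omega)) (hmono i hi)) hδ.le)
      (fun i hi ↦ mul_nonneg hδ.le (one_sub_exp_neg_div_nonneg (hpos i hi).le)) (by omega)
    have h4 : K * (δ * F (δ * Real.log (2 : ℕ))) ≤ K * (δ * 1) := by
      gcongr
      exact one_sub_exp_neg_div_le_one (hpos 2 le_rfl)
    have hlast : 1 ≤ δ * Real.log (N + 1 : ℕ) := hδL ▸ hmono N hN
    have h5 : (∫ v in (0 : ℝ)..1, F v) - δ ≤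
        ∫ v in (δ * Real.log (2 : ℕ))..(δ * Real.log (N + 1 : ℕ)), F v := by
      have hi : ∀ {a b : ℝ}, 0 ≤ a → 0 ≤ b → IntervalIntegrable F volume a b := fun ha hb ↦
        intervalIntegrable_one_sub_exp_neg_div ha hb
      have e1 := intervalIntegral.integral_add_adjacent_intervals
        (hi le_rfl (hpos 2 le_rfl).le) (hi (hpos 2 le_rfl).le (zero_le_one.trans hlast))
      have e2 := intervalIntegral.integral_add_adjacent_intervals
        (hi le_rfl zero_le_one) (hi zero_le_one (zero_le_one.trans hlast))
      have e3 : 0 ≤ ∫ v in (1 : ℝ)..(δ * Real.log (N + 1 : ℕ)), F v :=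
        intervalIntegral.integral_nonneg hlast fun v hv ↦
          one_sub_exp_neg_div_nonneg (zero_le_one.trans hv.1)
      have e4 : ∫ v in (0 : ℝ)..(δ * Real.log (2 : ℕ)), F v ≤ δ := by
        calc _ ≤ ∫ v in (0 : ℝ)..(δ * Real.log (2 : ℕ)), (1 : ℝ) := by
              refine intervalIntegral.integral_mono_on_of_le_Ioo (hpos 2 le_rfl).le
                (hi le_rfl (hpos 2 le_rfl).le) (by simp) fun v hv ↦
                  one_sub_exp_neg_div_le_one hv.1
          _ ≤ δ := by
              simp only [intervalIntegral.integral_const, smul_eq_mul, mul_one, sub_zero]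
              have : Real.log (2 : ℕ) ≤ 1 := by
                have := Real.log_two_lt_d9; push_cast; linarith
              nlinarith
      linarith
    simp only [sub_mul, Finset.sum_sub_distrib] at h3
    rw [h1]
    simp only [sub_mul, Finset.sum_sub_distrib] at h2
    linarith
  -- Primes beyond `N`, present in the product for `ζ(1+δ)` only, cost at most the second
  -- exponential integral up to `O(δ)`.
  have hlarge : ∑ n ∈ Finset.Ico (N + 1) (M + 1),
      (if n.Prime then (n : ℝ) ^ (-(1 + δ)) else 0) ≤
        (∫ v in Ioi (1 : ℝ), Real.exp (-v) / v) + δ * K := by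
    set F : ℝ → ℝ := fun v ↦ Real.exp (-v) / v with hF
    have h1 : ∑ n ∈ Finset.Ico (N + 1) (M + 1), (if n.Prime then (n : ℝ) ^ (-(1 + δ)) else 0) =
        ∑ n ∈ Finset.Ico (N + 1) (M + 1), primeLogDiv n * (δ * F (δ * Real.log n)) := by
      refine Finset.sum_congr rfl fun n _ ↦ ?_
      by_cases hn : n.Prime
      · rw [if_pos hn, primeLogDiv, if_pos hn, rpow_eq_log_div_mul hδ.ne' hn]
      · simp [primeLogDiv, hn]
    have h2 := sum_log_step_mul_le_integral (f := F) antitoneOn_exp_neg_div hδ hN hNM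
    have hFnn : ∀ v : ℝ, 0 < v → 0 ≤ F v := fun v hv ↦ by positivity
    have h3 := sum_Ico_mul_le_of_antitone (m := N + 1) (n := M + 1)
      (g := fun n : ℕ ↦ δ * F (δ * Real.log n)) (fun k hk ↦ (hK (N + 1) k (by omega) hk).1)
      (fun i hi ↦ mul_le_mul_of_nonneg_left (antitoneOn_exp_neg_div (hpos i (by omega))
        (hpos (i + 1) (by omega)) (hmono i (by omega))) hδ.le)
      (fun i hi ↦ mul_nonneg hδ.le (hFnn _ (hpos i (by omega)))) (by omega)
    have hlast : 1 ≤ δ * Real.log (N + 1 : ℕ) := hδL ▸ hmono N hN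
    have h4 : K * (δ * F (δ * Real.log (N + 1 : ℕ))) ≤ K * (δ * 1) := by
      gcongr
      rw [hF, div_le_one (by linarith)]
      refine le_trans (Real.exp_le_one_iff.2 (by linarith)) hlast
    have h5 : ∫ v in (δ * Real.log N)..(δ * Real.log M), F v ≤ ∫ v in Ioi (1 : ℝ), F v := by
      rw [hδL, intervalIntegral.integral_of_le (by rw [← hδL]; gcongr)]
      refine setIntegral_mono_set integral_Ioi_one_exp_neg_div.1 ?_
        (LE.le.eventuallyLE Ioc_subset_Ioi_self)
      exact (ae_restrict_iff' measurableSet_Ioi).2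
        (.of_forall fun v (hv : 1 < v) ↦ hFnn v (by linarith))
    simp only [sub_mul, Finset.sum_sub_distrib] at h3
    rw [h1]
    simp only [sub_mul, Finset.sum_sub_distrib] at h2
    linarith
  have hrp : ∀ p : ℕ, 2 ≤ p → (p : ℝ) ^ (-(1 + δ)) ≤ (p : ℝ)⁻¹ := fun p hp ↦ by
    rw [← Real.rpow_neg_one]
    have : (1 : ℝ) ≤ p := by exact_mod_cast (by omega : 1 ≤ p)
    exact Real.rpow_le_rpow_of_exponent_le this (by linarith)
  have htail : ∑ n ∈ Finset.Ico (N + 1) (M + 1),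
      (if n.Prime then -Real.log (1 - (n : ℝ) ^ (-(1 + δ))) else 0) ≤
      ∑ n ∈ Finset.Ico (N + 1) (M + 1), (if n.Prime then (n : ℝ) ^ (-(1 + δ)) else 0) +
        2 * δ := by
    have h1 : 2 * ∑ n ∈ Finset.Ico (N + 1) (M + 1), 1 / (n : ℝ) ^ 2 ≤ 2 * δ := by
      have h2 := sum_Ico_one_div_sq_le (by omega : 1 ≤ N) hNM
      have h3 : 1 / (N : ℝ) ≤ δ := by
        rw [hδ_def]
        gcongr
        exact Real.log_le_self (by linarith)
      linarith
    refine le_trans ?_ (add_le_add_right h1 _)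
    rw [Finset.mul_sum, ← Finset.sum_add_distrib]
    refine Finset.sum_le_sum fun n hn ↦ ?_
    have hn2 : 2 ≤ n := by have := (Finset.mem_Ico.1 hn).1; omega
    have hn2' : (2 : ℝ) ≤ n := by exact_mod_cast hn2
    split_ifs with hp
    · have h0 : 0 ≤ (n : ℝ) ^ (-(1 + δ)) := by positivity
      have h3 := hrp n hn2
      have h4 : (n : ℝ)⁻¹ ≤ 1 / 2 := by
        rw [inv_eq_one_div]; gcongr
      refine (neg_log_one_sub_le h0 (h3.trans h4)).trans ?_
      have : ((n : ℝ) ^ (-(1 + δ))) ^ 2 ≤ 1 / (n : ℝ) ^ 2 := by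
        rw [one_div, ← inv_pow]; gcongr
      linarith
    · positivity
  have hdiff : ∑ p ∈ Nat.primesLE N, ((p : ℝ)⁻¹ - (p : ℝ) ^ (-(1 + δ))) ≤
      ∑ p ∈ Nat.primesLE N, -Real.log (1 - (p : ℝ)⁻¹) -
      ∑ p ∈ Nat.primesLE N, -Real.log (1 - (p : ℝ) ^ (-(1 + δ))) := by
    rw [← Finset.sum_sub_distrib]
    refine Finset.sum_le_sum fun p hp ↦ ?_
    have h2 := Nat.two_le_of_mem_primesLE hp
    have h3 : (2 : ℝ) ≤ p := by exact_mod_cast h2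
    exact sub_le_log_one_sub_sub (by positivity) (hrp p h2) (inv_lt_one_of_one_lt₀ (by linarith))
  have hγ := integral_exp_eq_eulerMascheroniConstant
  have hloglog : Real.log (1 / δ) = Real.log (Real.log N) := by rw [hδ_def, one_div_one_div]
  have hC : (2 * K + 4) / Real.log N = (2 * K + 4) * δ := by rw [hδ_def]; ring
  rw [hC]
  rw [hloglog, hsplit] at hM
  linarith

/-- The lower bound in Mertens' third theorem. -/
theorem exists_prod_primesBelow_ge :
    ∃ C : ℝ, 0 ≤ C ∧ ∀ X : ℕ, 3 ≤ X →
      Real.exp Real.eulerMascheroniConstant * (Real.log X - C) ≤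
        ∏ p ∈ Nat.primesBelow X, (1 - (p : ℝ)⁻¹)⁻¹ := by
  obtain ⟨C, hC0, hC⟩ := exists_sum_neg_log_one_sub_inv_ge
  refine ⟨C + 1, by linarith, fun X hX ↦ ?_⟩
  obtain ⟨N, rfl⟩ : ∃ N, X = N + 1 := ⟨X - 1, by omega⟩
  have hN2 : (2 : ℝ) ≤ N := by exact_mod_cast (by omega : 2 ≤ N)
  have h := hC N (by omega)
  have hL : 0 < Real.log N := Real.log_pos (by linarith)
  have hp : ∀ p ∈ Nat.primesLE N, 0 < (1 - (p : ℝ)⁻¹)⁻¹ := fun p hp ↦ by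
    have h2 : (2 : ℝ) ≤ p := by exact_mod_cast Nat.two_le_of_mem_primesLE hp
    have := inv_lt_one_of_one_lt₀ (by linarith : (1 : ℝ) < p)
    exact inv_pos.2 (by linarith)
  have h1 : ∏ p ∈ Nat.primesLE N, (1 - (p : ℝ)⁻¹)⁻¹ =
      Real.exp (∑ p ∈ Nat.primesLE N, -Real.log (1 - (p : ℝ)⁻¹)) := by
    rw [Real.exp_sum]
    refine Finset.prod_congr rfl fun p hp' ↦ ?_
    rw [← Real.log_inv, Real.exp_log (hp p hp')]
  change _ ≤ ∏ p ∈ Nat.primesLE N, (1 - (p : ℝ)⁻¹)⁻¹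
  rw [h1]
  refine le_trans ?_ (Real.exp_le_exp.2 h)
  rw [sub_eq_add_neg (Real.log (Real.log N) + _), Real.exp_add, Real.exp_add, Real.exp_log hL]
  have h2 := Real.add_one_le_exp (-(C / Real.log N))
  have hk1 : Real.log (N + 1 : ℕ) ≤ Real.log N + 1 := by
    have : Real.log (N + 1 : ℕ) ≤ Real.log (N * Real.exp 1) := by
      refine Real.log_le_log (by positivity) ?_
      push_cast
      nlinarith [Real.add_one_le_exp 1]
    rwa [Real.log_mul (by positivity) (Real.exp_pos 1).ne', Real.log_exp] at this
  calc _ ≤ Real.exp Real.eulerMascheroniConstant * (Real.log N - C) := by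
        gcongr ?_ * ?_
        linarith
    _ = Real.log N * Real.exp Real.eulerMascheroniConstant * (-(C / Real.log N) + 1) := by
        field_simp; ring
    _ ≤ _ := by gcongr

/-! ### Chebyshev estimates for the size of the resonator -/

/-- Including a possible prime `p = X`, the first sum is `π(X) log X - θ(X)`, where the main terms
cancel and a logarithm is saved over the trivial bound. It will be `log R(0)`. -/
theorem exists_sum_log_div_le :
    ∃ K : ℝ, 0 < K ∧ ∀ᶠ X : ℕ in atTop,
      ∑ p ∈ Nat.primesBelow X, Real.log (X / p) ≤ K * (X / Real.log X) ∧
      ((Nat.primesBelow X).card : ℝ) ≤ K * (X / Real.log X) := by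
  obtain ⟨c, hc0, hc⟩ := Chebyshev.primeCounting_sub_theta_div_log_isBigO.exists_pos
  have h1 := tendsto_natCast_atTop_atTop.eventually hc.bound
  have h2 := tendsto_natCast_atTop_atTop.eventually
    (Chebyshev.eventually_primeCounting_le (ε := 1) one_pos)
  refine ⟨c + Real.log 4 + 1, by positivity, ?_⟩
  filter_upwards [h1, h2, eventually_ge_atTop 2] with X hX1 hX2 hX
  have hX0 : (2 : ℝ) ≤ X := by exact_mod_cast hX
  have hL : 0 < Real.log X := Real.log_pos (by linarith)
  have hl4 : 0 < Real.log 4 := Real.log_pos (by norm_num)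
  rw [Nat.floor_natCast] at hX1 hX2
  have hsub : Nat.primesBelow X ⊆ Nat.primesLE X := fun p hp ↦ by
    rw [Nat.mem_primesLE]
    exact ⟨(Nat.lt_of_mem_primesBelow hp).le, Nat.prime_of_mem_primesBelow hp⟩
  have hq : 0 ≤ X / Real.log X := by positivity
  constructor
  · calc _ ≤ ∑ p ∈ Nat.primesLE X, Real.log (X / p) := by
          refine Finset.sum_le_sum_of_subset_of_nonneg hsub fun p hp _ ↦ Real.log_nonneg ?_
          have hp1 : (0 : ℝ) < p := by exact_mod_cast (Nat.prime_of_mem_primesLE hp).pos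
          rw [one_le_div hp1]
          exact_mod_cast Nat.le_of_mem_primesLE hp
      _ = (Nat.primeCounting X - Chebyshev.theta X / Real.log X) * Real.log X := by
          rw [sub_mul, div_mul_cancel₀ _ hL.ne', Chebyshev.theta_eq_sum_primesLE_log,
            ← Nat.primesLE_card_eq_primeCounting, ← nsmul_eq_mul, ← Finset.sum_const,
            ← Finset.sum_sub_distrib]
          refine Finset.sum_congr rfl fun p hp ↦ ?_
          have hp1 : (p : ℝ) ≠ 0 := by exact_mod_cast (Nat.prime_of_mem_primesLE hp).ne_zero
          rw [Real.log_div (by linarith) hp1]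
      _ ≤ c * (X / Real.log X ^ 2) * Real.log X := by
          gcongr
          refine (le_abs_self _).trans (hX1.trans_eq ?_)
          rw [Real.norm_of_nonneg (by positivity)]
      _ = c * (X / Real.log X) := by field_simp
      _ ≤ _ := by gcongr; linarith
  · calc _ ≤ ((Nat.primesLE X).card : ℝ) := by exact_mod_cast Finset.card_le_card hsub
      _ = Nat.primeCounting X := by rw [Nat.primesLE_card_eq_primeCounting]
      _ ≤ _ := hX2
      _ = (Real.log 4 + 1) * (X / Real.log X) := by ring
      _ ≤ _ := by gcongr; linarith

/-! ### Approximation of `ζ(1+it)` by partial sums -/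

/-- The quantity is `(s-1) ∫ (x^(-s) - (m+1)^(-s))` over `[m, m+1]`, and `x^(-s)` varies there by at
most `|s| m^(-2)`. Two mean value estimates replace the integral. -/
theorem norm_cpow_sub_cpow_succ_sub_le {s : ℂ} (hs : 1 < s.re) {m : ℕ} (hm : 1 ≤ m) :
    ‖(m : ℂ) ^ (1 - s) - ((m + 1 : ℕ) : ℂ) ^ (1 - s) - (s - 1) * ((m + 1 : ℕ) : ℂ) ^ (-s)‖ ≤
      ‖s - 1‖ * (‖s‖ * (1 / (m : ℝ) ^ 2)) := by
  have hm1 : (1 : ℝ) ≤ m := by exact_mod_cast hm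
  have hs1 : 1 - s ≠ 0 := fun h ↦ by
    have : s = 1 := by linear_combination -h
    simp [this] at hs
  have hs0 : -s ≠ 0 := fun h ↦ by
    have : s = 0 := by linear_combination -h
    simp [this] at hs; linarith
  have hbound : ∀ x ∈ Icc (m : ℝ) (m + 1), ‖((m + 1 : ℝ) : ℂ) ^ (-s) - (x : ℂ) ^ (-s)‖ ≤
      ‖s‖ * (1 / (m : ℝ) ^ 2) := by
    intro x hx
    have h := (convex_Icc (m : ℝ) (m + 1)).norm_image_sub_le_of_norm_hasDerivWithin_le
      (f := fun y : ℝ ↦ (y : ℂ) ^ (-s)) (f' := fun y : ℝ ↦ -s * (y : ℂ) ^ (-s - 1))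
      (C := ‖s‖ * (1 / (m : ℝ) ^ 2)) (x := x) (y := m + 1)
      (fun y hy ↦ (hasDerivAt_ofReal_cpow_const (by linarith [hy.1]) hs0).hasDerivWithinAt) ?_ hx
      ⟨by linarith, le_rfl⟩
    · refine h.trans ?_
      have : ‖(m : ℝ) + 1 - x‖ ≤ 1 := by
        rw [Real.norm_of_nonneg (by linarith [hx.2])]; linarith [hx.1]
      exact mul_le_of_le_one_right (by positivity) this
    · intro y hy
      have hy0 : 0 < y := by linarith [hy.1]
      rw [norm_mul, norm_neg, Complex.norm_cpow_eq_rpow_re_of_pos hy0]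
      gcongr
      calc y ^ (-s - 1).re ≤ y ^ (-2 : ℝ) := by
            refine Real.rpow_le_rpow_of_exponent_le (by linarith [hy.1]) ?_
            simp; linarith
        _ ≤ (m : ℝ) ^ (-2 : ℝ) :=
            Real.rpow_le_rpow_of_nonpos (by linarith) hy.1 (by norm_num)
        _ = 1 / (m : ℝ) ^ 2 := by
            rw [Real.rpow_neg (by linarith), one_div]; norm_cast
  have h := (convex_Icc (m : ℝ) (m + 1)).norm_image_sub_le_of_norm_hasDerivWithin_le
      (f := fun y : ℝ ↦ (y : ℂ) ^ (1 - s) + (s - 1) * ((m + 1 : ℝ) : ℂ) ^ (-s) * y)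
      (f' := fun y : ℝ ↦ (1 - s) * (y : ℂ) ^ (1 - s - 1) + (s - 1) * ((m + 1 : ℝ) : ℂ) ^ (-s) * 1)
      (C := ‖s - 1‖ * (‖s‖ * (1 / (m : ℝ) ^ 2))) (x := m + 1) (y := m)
      (fun y hy ↦ ((hasDerivAt_ofReal_cpow_const (by linarith [hy.1]) hs1).add
        ((Complex.ofRealCLM.hasDerivAt).const_mul _)).hasDerivWithinAt) ?_
      ⟨by linarith, le_rfl⟩ ⟨le_rfl, by linarith⟩
  · have e : ‖(m : ℝ) - (m + 1)‖ = 1 := by simp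
    rw [e, mul_one] at h
    refine le_trans (le_of_eq ?_) h
    congr 1
    push_cast
    ring
  · intro y hy
    rw [show (1 - s) * (y : ℂ) ^ (1 - s - 1) + (s - 1) * ((m + 1 : ℝ) : ℂ) ^ (-s) * 1 =
      (s - 1) * (((m + 1 : ℝ) : ℂ) ^ (-s) - (y : ℂ) ^ (-s)) by
        rw [show 1 - s - 1 = -s by ring]; ring, norm_mul]
    gcongr
    exact hbound y hy

/-- After multiplication by `s - 1` the sum telescopes up to a summable error, and the two boundary
terms have norm at most `1`. The bound is uniform in `M`. -/
theorem norm_sum_Ico_cpow_neg_le {s : ℂ} (hs : 1 < s.re) {N M : ℕ} (hN : 1 ≤ N) (hNM : N ≤ M) :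
    ‖∑ n ∈ Finset.Ico (N + 1) (M + 1), (n : ℂ) ^ (-s)‖ ≤ 2 / ‖s - 1‖ + ‖s‖ * (2 / N) := by
  have hN1 : (1 : ℝ) ≤ N := by exact_mod_cast hN
  have hs1 : 0 < ‖s - 1‖ := norm_pos_iff.2 fun h ↦ by
    have : s = 1 := by linear_combination h
    simp [this] at hs
  have hb : ∀ k : ℕ, 1 ≤ k → ‖(k : ℂ) ^ (1 - s)‖ ≤ 1 := fun k hk ↦ by
    have hk1 : (1 : ℝ) ≤ k := by exact_mod_cast hk
    rw [Complex.norm_natCast_cpow_of_pos (by omega)]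
    exact Real.rpow_le_one_of_one_le_of_nonpos hk1 (by simp; linarith)
  have hsq : ∑ m ∈ Finset.Ico N M, 1 / (m : ℝ) ^ 2 ≤ 2 / (N : ℝ) := by
    rcases hNM.eq_or_lt with rfl | hlt
    · simp only [Finset.Ico_self, Finset.sum_empty]; positivity
    · obtain ⟨k, rfl⟩ : ∃ k, M = k + 1 := ⟨M - 1, by omega⟩
      rw [Finset.sum_eq_sum_Ico_succ_bot hlt]
      have := sum_Ico_one_div_sq_le hN (show N ≤ k by omega)
      have h2 : 1 / (N : ℝ) ^ 2 ≤ 1 / (N : ℝ) := by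
        gcongr
        nlinarith
      rw [show (2 : ℝ) / N = 1 / N + 1 / N by ring]
      linarith
  have htel := Finset.sum_Ico_sub (fun n : ℕ ↦ -((n : ℂ) ^ (1 - s))) hNM
  have hsum : ‖∑ m ∈ Finset.Ico N M, ((m : ℂ) ^ (1 - s) - ((m + 1 : ℕ) : ℂ) ^ (1 - s) -
      (s - 1) * ((m + 1 : ℕ) : ℂ) ^ (-s))‖ ≤ ‖s - 1‖ * (‖s‖ * (2 / N)) := by
    refine (norm_sum_le_of_le _ fun m hm ↦ norm_cpow_sub_cpow_succ_sub_le hs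
      (hN.trans (Finset.mem_Ico.1 hm).1)).trans ?_
    rw [← Finset.mul_sum, ← Finset.mul_sum]
    gcongr
  rw [Finset.sum_sub_distrib, ← Finset.mul_sum,
    Finset.sum_Ico_add' (fun n : ℕ ↦ (n : ℂ) ^ (-s)) N M 1] at hsum
  have htel' : ∑ m ∈ Finset.Ico N M, ((m : ℂ) ^ (1 - s) - ((m + 1 : ℕ) : ℂ) ^ (1 - s)) =
      (N : ℂ) ^ (1 - s) - (M : ℂ) ^ (1 - s) := by
    rw [show (N : ℂ) ^ (1 - s) - (M : ℂ) ^ (1 - s) =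
      -((M : ℂ) ^ (1 - s)) - -((N : ℂ) ^ (1 - s)) by ring, ← htel]
    exact Finset.sum_congr rfl fun m _ ↦ by ring
  rw [htel'] at hsum
  set A := ∑ n ∈ Finset.Ico (N + 1) (M + 1), (n : ℂ) ^ (-s)
  have h1 : ‖(s - 1) * A‖ ≤ 2 + ‖s - 1‖ * (‖s‖ * (2 / N)) := by
    have e : (s - 1) * A = ((N : ℂ) ^ (1 - s) - (M : ℂ) ^ (1 - s)) -
      ((N : ℂ) ^ (1 - s) - (M : ℂ) ^ (1 - s) - (s - 1) * A) := by ring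
    rw [e]
    refine (norm_sub_le _ _).trans (add_le_add ?_ hsum)
    refine (norm_sub_le _ _).trans ?_
    linarith [hb N hN, hb M (hN.trans hNM)]
  rw [norm_mul] at h1
  have : 2 / ‖s - 1‖ + ‖s‖ * (2 / N) = (2 + ‖s - 1‖ * (‖s‖ * (2 / N))) / ‖s - 1‖ := by
    field_simp
  rw [this, le_div_iff₀ hs1]
  linarith

theorem norm_riemannZeta_sub_sum_le_of_one_lt {s : ℂ} (hs : 1 < s.re) {N : ℕ} (hN : 1 ≤ N) :
    ‖riemannZeta s - ∑ n ∈ Finset.Ico 1 (N + 1), (n : ℂ) ^ (-s)‖ ≤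
      2 / ‖s - 1‖ + ‖s‖ * (2 / N) := by
  have hs0 : -s ≠ 0 := fun h ↦ by
    have : s = 0 := by linear_combination -h
    simp [this] at hs; linarith
  have hsum : HasSum (fun n : ℕ ↦ (n : ℂ) ^ (-s)) (riemannZeta s) := by
    have h1 := (Complex.summable_one_div_nat_cpow.2 hs).hasSum
    rw [← zeta_eq_tsum_one_div_nat_cpow hs] at h1
    simpa [Complex.cpow_neg] using h1
  have hlim := ((hsum.tendsto_sum_nat.comp (tendsto_add_atTop_nat 1)).sub_const
    (∑ n ∈ Finset.Ico 1 (N + 1), (n : ℂ) ^ (-s))).norm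
  refine le_of_tendsto hlim ?_
  filter_upwards [eventually_ge_atTop N] with M hM
  have : ∑ n ∈ Finset.range (M + 1), (n : ℂ) ^ (-s) =
      ∑ n ∈ Finset.Ico 1 (M + 1), (n : ℂ) ^ (-s) := by
    rw [Finset.range_eq_Ico, Finset.sum_eq_sum_Ico_succ_bot (by omega)]
    simp [Complex.zero_cpow hs0]
  simp only [Function.comp_apply]
  rw [this, ← Finset.sum_Ico_consecutive _ (show 1 ≤ N + 1 by omega)
    (show N + 1 ≤ M + 1 by omega), add_sub_cancel_left]
  exact norm_sum_Ico_cpow_neg_le hs hN hM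

/-- On the line `Re s = 1`, `ζ` is approximated by its partial sums up to a bounded error. -/
theorem norm_riemannZeta_one_add_sub_sum_le {t : ℝ} (ht : 1 ≤ t) {N : ℕ} (htN : t ≤ N) :
    ‖riemannZeta (1 + (t : ℂ) * Complex.I) -
      ∑ n ∈ Finset.Ico 1 (N + 1), (n : ℂ) ^ (-(1 + (t : ℂ) * Complex.I))‖ ≤ 6 := by
  have hN1 : (1 : ℝ) ≤ N := ht.trans htN
  have hN : 1 ≤ N := by exact_mod_cast hN1
  set s₀ : ℂ := 1 + (t : ℂ) * Complex.I with hs₀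
  have hne : s₀ ≠ 1 := fun h ↦ by
    have := congrArg Complex.im h
    simp [hs₀] at this
    linarith
  have hsum_cont : ContinuousAt (fun s : ℂ ↦ ∑ n ∈ Finset.Ico 1 (N + 1), (n : ℂ) ^ (-s)) s₀ := by
    refine tendsto_finsetSum _ fun n hn ↦ ?_
    have hn0 : (n : ℂ) ≠ 0 := by
      exact_mod_cast (show n ≠ 0 by have := (Finset.mem_Ico.1 hn).1; omega)
    exact (continuousAt_neg.const_cpow (Or.inl hn0))
  have hcont : ContinuousAt (fun s : ℂ ↦ ‖riemannZeta s -
      ∑ n ∈ Finset.Ico 1 (N + 1), (n : ℂ) ^ (-s)‖) s₀ :=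
    ((differentiableAt_riemannZeta hne).continuousAt.sub hsum_cont).norm
  have hcont2 : ContinuousAt (fun s : ℂ ↦ 2 / ‖s - 1‖ + ‖s‖ * (2 / N)) s₀ := by
    have : ‖s₀ - 1‖ ≠ 0 := norm_ne_zero_iff.2 (sub_ne_zero.2 hne)
    fun_prop (disch := assumption)
  -- The estimate is known where the Dirichlet series converges absolutely; both sides are
  -- continuous at `s₀ ≠ 1`, so it passes to the line from the right.
  have hpath : Tendsto (fun ε : ℝ ↦ s₀ + ε) (𝓝[>] 0) (𝓝 s₀) := by
    have : Continuous fun ε : ℝ ↦ s₀ + ε := by fun_prop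
    simpa using (this.tendsto 0).mono_left nhdsWithin_le_nhds
  have hle := le_of_tendsto_of_tendsto (hcont.tendsto.comp hpath) (hcont2.tendsto.comp hpath) ?_
  · refine hle.trans ?_
    have e1 : ‖s₀ - 1‖ = t := by
      simp [hs₀, abs_of_nonneg (zero_le_one.trans ht)]
    have e2 : ‖s₀‖ ≤ 2 * N := by
      calc ‖s₀‖ ≤ ‖(1 : ℂ)‖ + ‖(t : ℂ) * Complex.I‖ := norm_add_le _ _
        _ = 1 + t := by simp [abs_of_nonneg (zero_le_one.trans ht)]
        _ ≤ _ := by linarith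
    rw [e1]
    have e3 : 2 / t ≤ 2 := by rw [div_le_iff₀ (by linarith)]; linarith
    have e4 : ‖s₀‖ * (2 / N) ≤ 2 * N * (2 / N) := by gcongr
    have e5 : 2 * (N : ℝ) * (2 / N) = 4 := by field_simp; norm_num
    linarith
  · filter_upwards [self_mem_nhdsWithin] with ε (hε : 0 < ε)
    exact norm_riemannZeta_sub_sum_le_of_one_lt (by simp [hs₀, hε]) hN

/-! ### Positive trigonometric series and the weight `1 - t/T` -/

theorem hasSum_congr_of_eq {ι : Type*} {α : Type*} [AddCommMonoid α] [TopologicalSpace α]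
    {f g : ι → α} {a : α} (h : ∀ i, f i = g i) :
    HasSum f a ↔ HasSum g a := by
  rw [funext h]

/-- A function on the real line is an absolutely convergent trigonometric series with nonnegative
coefficients (and arbitrary real frequencies). -/
def IsPosTrigSeries (f : ℝ → ℂ) : Prop :=
  ∃ (ι : Type) (_ : Countable ι) (u α : ι → ℝ), (∀ i, 0 ≤ u i) ∧ Summable u ∧
    ∀ t : ℝ, HasSum (fun i ↦ (u i : ℂ) * Complex.exp ((α i * t : ℝ) * Complex.I)) (f t)

theorem norm_ofReal_mul_exp_ofReal_mul_I (u x : ℝ) :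
    ‖(u : ℂ) * Complex.exp (x * Complex.I)‖ = ‖u‖ := by
  rw [norm_mul, Complex.norm_exp_ofReal_mul_I, mul_one, Complex.norm_real]

namespace IsPosTrigSeries

theorem mul {f g : ℝ → ℂ} (hf : IsPosTrigSeries f) (hg : IsPosTrigSeries g) :
    IsPosTrigSeries fun t ↦ f t * g t := by
  obtain ⟨ι, _, u, α, hu, hus, hf⟩ := hf
  obtain ⟨κ, _, v, β, hv, hvs, hg⟩ := hg
  refine ⟨ι × κ, inferInstance, fun i ↦ u i.1 * v i.2, fun i ↦ α i.1 + β i.2,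
    fun i ↦ mul_nonneg (hu _) (hv _), hus.mul_of_nonneg hvs hu hv, fun t ↦ ?_⟩
  have hs := summable_mul_of_summable_norm
    (f := fun i ↦ (u i : ℂ) * Complex.exp ((α i * t : ℝ) * Complex.I))
    (g := fun i ↦ (v i : ℂ) * Complex.exp ((β i * t : ℝ) * Complex.I))
    (by simpa only [norm_ofReal_mul_exp_ofReal_mul_I] using hus.norm)
    (by simpa only [norm_ofReal_mul_exp_ofReal_mul_I] using hvs.norm)
  refine (hasSum_congr_of_eq fun i ↦ ?_).1 ((hf t).mul (hg t) hs)
  simp only [add_mul, Complex.ofReal_add, Complex.exp_add, Complex.ofReal_mul]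
  ring

theorem conj {f : ℝ → ℂ} (hf : IsPosTrigSeries f) : IsPosTrigSeries fun t ↦ starRingEnd ℂ (f t) := by
  obtain ⟨ι, _, u, α, hu, hus, hf⟩ := hf
  refine ⟨ι, inferInstance, u, fun i ↦ -α i, hu, hus, fun t ↦ ?_⟩
  refine (hasSum_congr_of_eq fun i ↦ ?_).1 (Complex.hasSum_conj'.2 (hf t))
  rw [map_mul, ← Complex.exp_conj, map_mul, Complex.conj_ofReal, Complex.conj_ofReal,
    Complex.conj_I]
  push_cast
  ring_nf

theorem continuous {f : ℝ → ℂ} (hf : IsPosTrigSeries f) : Continuous f := by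
  obtain ⟨ι, _, u, α, hu, hus, hf⟩ := hf
  have : f = fun t ↦ ∑' i, (u i : ℂ) * Complex.exp ((α i * t : ℝ) * Complex.I) :=
    funext fun t ↦ (hf t).tsum_eq.symm
  rw [this]
  refine continuous_tsum (fun i ↦ by fun_prop) hus.norm fun i t ↦ ?_
  rw [norm_ofReal_mul_exp_ofReal_mul_I]

end IsPosTrigSeries

/-- For `α ≠ 0` the integral equals `(1 - cos(αT)) / (α² T)`, a Fejér kernel. -/
theorem integral_one_sub_div_mul_cos_nonneg {T : ℝ} (hT : 0 < T) (α : ℝ) :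
    0 ≤ ∫ t in (0 : ℝ)..T, (1 - t / T) * Real.cos (α * t) := by
  rcases eq_or_ne α 0 with rfl | hα
  · refine intervalIntegral.integral_nonneg hT.le fun t ht ↦ ?_
    simp only [zero_mul, Real.cos_zero, mul_one, sub_nonneg]
    rw [div_le_one hT]
    exact ht.2
  · have h := intervalIntegral.integral_eq_sub_of_hasDerivAt (a := 0) (b := T)
      (f := fun t ↦ (1 - t / T) * (Real.sin (α * t) / α) - Real.cos (α * t) / (α ^ 2 * T))
      (f' := fun t ↦ (1 - t / T) * Real.cos (α * t)) (fun t _ ↦ ?_)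
      (Continuous.intervalIntegrable (by fun_prop) _ _)
    · rw [h]
      have := Real.cos_le_one (α * T)
      rw [div_self hT.ne']
      simp only [sub_self, zero_mul, mul_zero, Real.sin_zero, Real.cos_zero, zero_div, zero_sub]
      rw [sub_neg_eq_add, neg_add_eq_sub, ← sub_div]
      exact div_nonneg (by linarith) (by positivity)
    · have e : HasDerivAt (fun t ↦ α * t) α t := by simpa using (hasDerivAt_id t).const_mul α
      have h1 : HasDerivAt (fun t ↦ 1 - t / T) (-(1 / T)) t :=
        ((hasDerivAt_id t).div_const T).const_sub 1
      refine ((h1.mul (e.sin.div_const α)).sub (e.cos.div_const (α ^ 2 * T))).congr_deriv ?_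
      field_simp
      ring

theorem IsPosTrigSeries.integral_re_nonneg {f : ℝ → ℂ} (hf : IsPosTrigSeries f) {T : ℝ}
    (hT : 0 < T) : 0 ≤ ∫ t in (0 : ℝ)..T, (1 - t / T) * (f t).re := by
  obtain ⟨ι, _, u, α, hu, hus, hf⟩ := hf
  have hre : ∀ t, HasSum (fun i ↦ u i * Real.cos (α i * t)) (f t).re := fun t ↦ by
    refine (hasSum_congr_of_eq fun i ↦ ?_).1 (Complex.hasSum_re (hf t))
    rw [Complex.re_ofReal_mul, Complex.exp_ofReal_mul_I_re]
  have hw : ∀ t ∈ uIoc 0 T, |1 - t / T| ≤ 1 := fun t ht ↦ by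
    rw [uIoc_of_le hT.le] at ht
    have h1 : 0 ≤ t / T := div_nonneg ht.1.le hT.le
    have h2 : t / T ≤ 1 := (div_le_one hT).2 ht.2
    rw [abs_le]
    constructor <;> linarith
  have h := intervalIntegral.hasSum_integral_of_dominated_convergence (μ := volume) (a := 0) (b := T)
    (F := fun i t ↦ (1 - t / T) * (u i * Real.cos (α i * t)))
    (f := fun t ↦ (1 - t / T) * (f t).re) (fun i _ ↦ u i)
    (fun i ↦ (Continuous.aestronglyMeasurable (by fun_prop)))
    (fun i ↦ .of_forall fun t ht ↦ ?_) (.of_forall fun _ _ ↦ hus)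
    (by simp) (.of_forall fun t _ ↦ (hre t).mul_left _)
  · refine h.nonneg fun i ↦ ?_
    have e : ∀ t, (1 - t / T) * (u i * Real.cos (α i * t)) =
      u i * ((1 - t / T) * Real.cos (α i * t)) := fun t ↦ by ring
    simp only [e, intervalIntegral.integral_const_mul]
    exact mul_nonneg (hu i) (integral_one_sub_div_mul_cos_nonneg hT _)
  · rw [norm_mul, norm_mul, Real.norm_eq_abs, Real.norm_of_nonneg (hu i), Real.norm_eq_abs]
    calc _ ≤ 1 * (u i * 1) := by
          gcongr
          exacts [mul_nonneg (hu i) (abs_nonneg _), hw t ht, hu i, Real.abs_cos_le_one _]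
      _ = u i := by ring

/-! ### The resonator and its weighted moments -/

/-- `∑ r(a) a ^ (it)`. -/
noncomputable def resonator (r : ℕ → ℝ) (t : ℝ) : ℂ :=
  ∑' a : ℕ, (r a : ℂ) * Complex.exp ((Real.log a * t : ℝ) * Complex.I)

theorem summable_resonator {r : ℕ → ℝ} (hr : Summable r) (t : ℝ) :
    Summable fun a : ℕ ↦ (r a : ℂ) * Complex.exp ((Real.log a * t : ℝ) * Complex.I) := by
  refine Summable.of_norm ?_
  simpa only [norm_ofReal_mul_exp_ofReal_mul_I] using hr.norm

theorem isPosTrigSeries_resonator {r : ℕ → ℝ} (hr0 : ∀ a, 0 ≤ r a) (hr : Summable r) :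
    IsPosTrigSeries (resonator r) :=
  ⟨ℕ, inferInstance, r, fun a ↦ Real.log a, hr0, hr, fun t ↦ (summable_resonator hr t).hasSum⟩

theorem norm_resonator_le {r : ℕ → ℝ} (hr0 : ∀ a, 0 ≤ r a) (hr : Summable r) (t : ℝ) :
    ‖resonator r t‖ ≤ ∑' a, r a := by
  refine tsum_of_norm_bounded hr.hasSum fun a ↦ ?_
  rw [norm_ofReal_mul_exp_ofReal_mul_I, Real.norm_of_nonneg (hr0 a)]

/-- The terms `a = nb` of `R(t) n^(-it)` reproduce `r(n) R(t)` by complete multiplicativity. What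
remains is the sum over `a` not divisible by `n`, with coefficients `r(a) ≥ 0`. -/
theorem isPosTrigSeries_resonator_mul_sub {r : ℕ →*₀ ℝ} (hr0 : ∀ a, 0 ≤ r a) (hr : Summable r)
    {n : ℕ} (hn : n ≠ 0) :
    IsPosTrigSeries fun t ↦
      resonator r t * Complex.exp ((-Real.log n * t : ℝ) * Complex.I) - r n * resonator r t := by
  refine ⟨ℕ, inferInstance, fun a ↦ if n ∣ a then 0 else r a, fun a ↦ Real.log a - Real.log n, fun a ↦ ?_, ?_,
    fun t ↦ ?_⟩
  · dsimp only; split_ifs; exacts [le_rfl, hr0 a]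
  · refine hr.of_nonneg_of_le (fun a ↦ ?_) fun a ↦ ?_ <;> split_ifs
    exacts [le_rfl, hr0 a, hr0 a, le_rfl]
  have hR := (summable_resonator hr t).hasSum
  have h1 := hR.mul_right (Complex.exp ((-Real.log n * t : ℝ) * Complex.I))
  have h2 := hR.mul_left (r n : ℂ)
  have hinj : Function.Injective fun b : ℕ ↦ n * b := fun a b h ↦ Nat.eq_of_mul_eq_mul_left (Nat.pos_of_ne_zero hn) h
  have h3 : HasSum (fun a : ℕ ↦ if n ∣ a then
      (r a : ℂ) * Complex.exp (((Real.log a - Real.log n) * t : ℝ) * Complex.I) else 0)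
      (r n * resonator r t) := by
    rw [← hinj.hasSum_iff]
    · refine (hasSum_congr_of_eq fun b ↦ ?_).1 h2
      rcases eq_or_ne b 0 with rfl | hb
      · simp
      · simp only [Function.comp_apply, dvd_mul_right, if_true, map_mul]
        rw [Nat.cast_mul, Real.log_mul (by exact_mod_cast hn) (by exact_mod_cast hb),
          add_sub_cancel_left]
        push_cast
        ring
    · intro a ha
      rw [if_neg]
      rintro ⟨b, rfl⟩
      exact ha ⟨b, rfl⟩
  refine (hasSum_congr_of_eq fun a ↦ ?_).1 (h1.sub h3)
  have e : Complex.exp ((Real.log a * t : ℝ) * Complex.I) *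
      Complex.exp ((-Real.log n * t : ℝ) * Complex.I) =
      Complex.exp (((Real.log a - Real.log n) * t : ℝ) * Complex.I) := by
    rw [← Complex.exp_add]; congr 1; push_cast; ring
  rw [mul_assoc, e]
  by_cases h : n ∣ a <;> simp [h]

theorem integral_one_sub_div {T : ℝ} (hT : 0 < T) : ∫ t in (0 : ℝ)..T, (1 - t / T) = T / 2 := by
  rw [intervalIntegral.integral_sub (by simp) (Continuous.intervalIntegrable (by fun_prop) _ _)]
  simp only [intervalIntegral.integral_const, intervalIntegral.integral_div, integral_id]
  field_simp
  ring

theorem isPosTrigSeries_resonator_sub_one {r : ℕ →*₀ ℝ} (hr0 : ∀ a, 0 ≤ r a) (hr : Summable r) :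
    IsPosTrigSeries fun t ↦ resonator r t - 1 := by
  refine ⟨ℕ, inferInstance, fun a ↦ if a = 1 then 0 else r a, fun a ↦ Real.log a, fun a ↦ ?_, ?_,
    fun t ↦ ?_⟩
  · dsimp only; split_ifs; exacts [le_rfl, hr0 a]
  · refine hr.of_nonneg_of_le (fun a ↦ ?_) fun a ↦ ?_ <;> split_ifs
    exacts [le_rfl, hr0 a, hr0 a, le_rfl]
  · refine (hasSum_congr_of_eq fun a ↦ ?_).1
      ((summable_resonator hr t).hasSum.sub (hasSum_ite_eq (1 : ℕ) (1 : ℂ)))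
    by_cases h : a = 1 <;> simp [h]

theorem intervalIntegrable_weight_mul {f : ℝ → ℝ} (hf : Continuous f) (T : ℝ) :
    IntervalIntegrable (fun t ↦ (1 - t / T) * f t) volume 0 T :=
  Continuous.intervalIntegrable (by fun_prop) _ _

/-- Since `r(1) = 1`, `|R|² = 1 + Re(R - 1) + Re((R - 1) conj R)`. The last two terms are real parts
of positive series, and the weight has integral `T/2`. -/
theorem half_le_integral_normSq_resonator {r : ℕ →*₀ ℝ} (hr0 : ∀ a, 0 ≤ r a) (hr : Summable r)
    {T : ℝ} (hT : 0 < T) :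
    T / 2 ≤ ∫ t in (0 : ℝ)..T, (1 - t / T) * Complex.normSq (resonator r t) := by
  have hR := isPosTrigSeries_resonator hr0 hr
  have hQ := isPosTrigSeries_resonator_sub_one hr0 hr
  have h1 := (hQ.mul hR.conj).integral_re_nonneg hT
  have h2 := hQ.integral_re_nonneg hT
  have e : ∀ t, (1 - t / T) * Complex.normSq (resonator r t) = (1 - t / T) +
      ((1 - t / T) * (resonator r t - 1).re + (1 - t / T) *
        ((resonator r t - 1) * starRingEnd ℂ (resonator r t)).re) := fun t ↦ by
    simp [Complex.normSq_apply]
    ring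
  simp only [e]
  have i1 := intervalIntegrable_weight_mul (Complex.continuous_re.comp hQ.continuous) T
  have i2 := intervalIntegrable_weight_mul
    (Complex.continuous_re.comp (hQ.mul hR.conj).continuous) T
  simp only [Function.comp_apply] at i1 i2
  rw [intervalIntegral.integral_add (Continuous.intervalIntegrable (by fun_prop) _ _) (i1.add i2),
    intervalIntegral.integral_add i1 i2, integral_one_sub_div hT]
  linarith

theorem natCast_cpow_neg_one_add {n : ℕ} (hn : n ≠ 0) (t : ℝ) :
    (n : ℂ) ^ (-(1 + (t : ℂ) * Complex.I)) =
      ((1 / n : ℝ) : ℂ) * Complex.exp ((-Real.log n * t : ℝ) * Complex.I) := by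
  have hn0 : (n : ℂ) ≠ 0 := by exact_mod_cast hn
  rw [neg_add, Complex.cpow_add _ _ hn0, Complex.cpow_neg_one, Complex.cpow_def_of_ne_zero hn0,
    ← Complex.natCast_log]
  push_cast
  rw [one_div]
  ring_nf

theorem continuous_sum_natCast_cpow (M : ℕ) :
    Continuous fun t : ℝ ↦
      ∑ n ∈ Finset.Ico 1 (M + 1), (n : ℂ) ^ (-(1 + (t : ℂ) * Complex.I)) := by
  refine continuous_finsetSum _ fun n hn ↦ ?_
  have hn0 : n ≠ 0 := by have := (Finset.mem_Ico.1 hn).1; omega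
  simp only [natCast_cpow_neg_one_add hn0]
  fun_prop

/-- Term by term, `|R|² (n^(-it) - r(n))` is the positive series `R n^(-it) - r(n) R` times `conj
R`, so its weighted integral has nonnegative real part. -/
theorem sum_mul_integral_le_integral_mul_re_sum {r : ℕ →*₀ ℝ} (hr0 : ∀ a, 0 ≤ r a)
    (hr : Summable r) {T : ℝ} (hT : 0 < T) (M : ℕ) :
    (∑ n ∈ Finset.Ico 1 (M + 1), r n / n) *
        ∫ t in (0 : ℝ)..T, (1 - t / T) * Complex.normSq (resonator r t) ≤
      ∫ t in (0 : ℝ)..T, (1 - t / T) * (Complex.normSq (resonator r t) *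
        (∑ n ∈ Finset.Ico 1 (M + 1), (n : ℂ) ^ (-(1 + (t : ℂ) * Complex.I))).re) := by
  have hR := isPosTrigSeries_resonator hr0 hr
  have hW : Continuous fun t ↦ Complex.normSq (resonator r t) :=
    Complex.continuous_normSq.comp hR.continuous
  have hcont : ∀ n ∈ Finset.Ico 1 (M + 1), Continuous fun t : ℝ ↦
      Complex.normSq (resonator r t) * ((n : ℂ) ^ (-(1 + (t : ℂ) * Complex.I))).re := by
    intro n hn
    have hn0 : n ≠ 0 := by have := (Finset.mem_Ico.1 hn).1; omega
    simp only [natCast_cpow_neg_one_add hn0]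
    exact hW.mul (by fun_prop)
  simp only [Complex.re_sum, Finset.mul_sum]
  rw [intervalIntegral.integral_finsetSum fun n hn ↦
    intervalIntegrable_weight_mul (hcont n hn) T, Finset.sum_mul]
  refine Finset.sum_le_sum fun n hn ↦ ?_
  have hn0 : n ≠ 0 := by have := (Finset.mem_Ico.1 hn).1; omega
  have hQ := (isPosTrigSeries_resonator_mul_sub hr0 hr hn0).mul hR.conj
  have h1 := hQ.integral_re_nonneg hT
  have e : ∀ t : ℝ, (1 - t / T) *
      (Complex.normSq (resonator r t) * ((n : ℂ) ^ (-(1 + (t : ℂ) * Complex.I))).re) =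
      r n / n * ((1 - t / T) * Complex.normSq (resonator r t)) + 1 / n * ((1 - t / T) *
        ((resonator r t * Complex.exp ((-Real.log n * t : ℝ) * Complex.I) - r n * resonator r t) *
          starRingEnd ℂ (resonator r t)).re) := fun t ↦ by
    have e1 : (resonator r t * Complex.exp ((-Real.log n * t : ℝ) * Complex.I) -
        r n * resonator r t) * starRingEnd ℂ (resonator r t) =
        (Complex.normSq (resonator r t) : ℂ) *
          (Complex.exp ((-Real.log n * t : ℝ) * Complex.I) - r n) := by
      rw [← Complex.mul_conj]; ring
    rw [e1, natCast_cpow_neg_one_add hn0, Complex.re_ofReal_mul, Complex.re_ofReal_mul,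
      Complex.sub_re, Complex.ofReal_re]
    ring
  simp only [e]
  have i1 := intervalIntegrable_weight_mul hW T
  have i2 := intervalIntegrable_weight_mul (Complex.continuous_re.comp hQ.continuous) T
  simp only [Function.comp_apply] at i2
  rw [intervalIntegral.integral_add (i1.const_mul _) (i2.const_mul _),
    intervalIntegral.integral_const_mul, intervalIntegral.integral_const_mul]
  have : 0 ≤ 1 / (n : ℝ) := by positivity
  nlinarith [mul_nonneg this h1]

/-! ### Euler products and the choice of the resonator -/

/-- Vanishing at the primes from `X` on confines the support to the `X`-smooth numbers, where the
Euler product is finite. -/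
theorem hasSum_prod_primesBelow_of_eq_zero {f : ℕ →*₀ ℝ} (hf0 : ∀ a, 0 ≤ f a) {X : ℕ}
    (hlt : ∀ p : ℕ, p.Prime → f p < 1) (hX : ∀ p : ℕ, p.Prime → X ≤ p → f p = 0) :
    HasSum f (∏ p ∈ Nat.primesBelow X, (1 - f p)⁻¹) := by
  have h := (EulerProduct.summable_and_hasSum_smoothNumbers_prod_primesBelow_geometric
    (f := f.toMonoidHom) (fun {p} hp ↦ by
      change ‖f p‖ < 1
      rw [Real.norm_of_nonneg (hf0 p)]; exact hlt p hp) X).2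
  refine (hasSum_subtype_iff_of_support_subset (s := Nat.smoothNumbers X) ?_).1 h
  intro m hm
  have hm' : f m ≠ 0 := hm
  have hm0 : m ≠ 0 := by rintro rfl; exact hm' (map_zero f)
  rw [Nat.mem_smoothNumbers]
  refine ⟨hm0, fun p hp ↦ ?_⟩
  by_contra hpX
  obtain ⟨k, rfl⟩ := Nat.dvd_of_mem_primeFactorsList hp
  exact hm' (by rw [map_mul, hX p (Nat.prime_of_mem_primeFactorsList hp) (not_lt.1 hpX), zero_mul])

/-- The completely multiplicative function with prescribed values at the primes. -/
noncomputable def completelyMultiplicative (g : ℕ → ℝ) : ℕ →*₀ ℝ where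
  toFun n := if n = 0 then 0 else n.factorization.prod fun p k ↦ g p ^ k
  map_zero' := by simp
  map_one' := by simp
  map_mul' m n := by
    rcases eq_or_ne m 0 with rfl | hm
    · simp
    rcases eq_or_ne n 0 with rfl | hn
    · simp
    rw [if_neg hm, if_neg hn, if_neg (mul_ne_zero hm hn), Nat.factorization_mul hm hn,
      Finsupp.prod_add_index' (by simp) (fun a b c ↦ pow_add _ _ _)]

theorem completelyMultiplicative_prime (g : ℕ → ℝ) {p : ℕ} (hp : p.Prime) :
    completelyMultiplicative g p = g p := by
  change (if p = 0 then 0 else p.factorization.prod fun p k ↦ g p ^ k) = g p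
  rw [if_neg hp.ne_zero, hp.factorization, Finsupp.prod_single_index (by simp), pow_one]

theorem completelyMultiplicative_nonneg {g : ℕ → ℝ} (hg : ∀ p, 0 ≤ g p) (n : ℕ) :
    0 ≤ completelyMultiplicative g n := by
  change 0 ≤ if n = 0 then 0 else n.factorization.prod fun p k ↦ g p ^ k
  split_ifs
  · exact le_rfl
  · exact Finset.prod_nonneg fun p _ ↦ pow_nonneg (hg p) _

/-- The map `n ↦ n⁻¹` as a completely multiplicative function. -/
noncomputable def natInvHom : ℕ →*₀ ℝ where
  toFun n := (n : ℝ)⁻¹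
  map_zero' := by simp
  map_one' := by simp
  map_mul' m n := by push_cast; rw [mul_inv]

theorem exists_resonator_coefficients :
    ∃ K C : ℝ, 0 < K ∧ ∀ᶠ X : ℕ in atTop, ∃ r : ℕ →*₀ ℝ, (∀ a, 0 ≤ r a) ∧ Summable r ∧
      ∑' a, r a ≤ Real.exp (K * (X / Real.log X)) ∧
      ∀ M : ℕ, 1 ≤ M → Real.exp Real.eulerMascheroniConstant * (Real.log X - C) -
        (∑' a, r a) / M ≤ ∑ n ∈ Finset.Ico 1 (M + 1), r n / n := by
  obtain ⟨K, hK0, hK⟩ := exists_sum_log_div_le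
  obtain ⟨C, hC0, hC⟩ := exists_prod_primesBelow_ge
  have hlog : ∀ᶠ X : ℕ in atTop, C ≤ Real.log X :=
    (Real.tendsto_log_atTop.comp tendsto_natCast_atTop_atTop).eventually_ge_atTop C
  refine ⟨K, C + 2 * K, hK0, ?_⟩
  filter_upwards [hK, hlog, eventually_ge_atTop 3] with X hKX hlogX hX
  have hX0 : (3 : ℝ) ≤ X := by exact_mod_cast hX
  have hL : 0 < Real.log X := Real.log_pos (by linarith)
  -- The factors `(1 - r(p))⁻¹ = X/p` keep `R(0)` small, while `r(p)/p` differs from `1/p` only by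
  -- `1/X`.
  set g : ℕ → ℝ := fun p ↦ max (1 - p / X) 0 with hg
  set r := completelyMultiplicative g with hr
  have hr0 : ∀ a, 0 ≤ r a := completelyMultiplicative_nonneg fun p ↦ le_max_right _ _
  have hrp : ∀ p : ℕ, p.Prime → r p = g p := fun p hp ↦ completelyMultiplicative_prime g hp
  have hlt : ∀ p : ℕ, p.Prime → r p < 1 := fun p hp ↦ by
    rw [hrp p hp]
    have : (0 : ℝ) < p := by exact_mod_cast hp.pos
    exact max_lt (by linarith [div_pos this (by linarith : (0 : ℝ) < X)]) one_pos
  have hz : ∀ p : ℕ, p.Prime → X ≤ p → r p = 0 := fun p hp hpX ↦ by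
    rw [hrp p hp]
    refine max_eq_right ?_
    have : (X : ℝ) ≤ p := by exact_mod_cast hpX
    rw [sub_nonpos, one_le_div (by linarith)]
    exact this
  have hval : ∀ p ∈ Nat.primesBelow X, r p = 1 - p / X := fun p hp ↦ by
    rw [hrp p (Nat.prime_of_mem_primesBelow hp)]
    refine max_eq_left ?_
    have : (p : ℝ) ≤ X := by exact_mod_cast (Nat.lt_of_mem_primesBelow hp).le
    rw [sub_nonneg, div_le_one (by linarith)]
    exact this
  have hp2 : ∀ p ∈ Nat.primesBelow X, (2 : ℝ) ≤ p := fun p hp ↦ by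
    exact_mod_cast (Nat.prime_of_mem_primesBelow hp).two_le
  have hsum := hasSum_prod_primesBelow_of_eq_zero hr0 hlt hz
  have hdiv_apply : ∀ n : ℕ, (r * natInvHom) n = r n / n := fun n ↦ (div_eq_mul_inv _ _).symm
  have hsum2 := hasSum_prod_primesBelow_of_eq_zero (f := r * natInvHom) (X := X)
    (fun a ↦ by rw [hdiv_apply]; exact div_nonneg (hr0 a) (by positivity))
    (fun p hp ↦ by
      rw [hdiv_apply]
      have : (1 : ℝ) ≤ p := by exact_mod_cast hp.one_le
      exact (div_le_self (hr0 p) this).trans_lt (hlt p hp))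
    (fun p hp hpX ↦ by rw [hdiv_apply, hz p hp hpX, zero_div])
  refine ⟨r, hr0, hsum.summable, ?_, fun M hM ↦ ?_⟩
  · rw [hsum.tsum_eq]
    refine le_trans (le_of_eq ?_) (Real.exp_le_exp.2 hKX.1)
    rw [Real.exp_sum]
    refine Finset.prod_congr rfl fun p hp ↦ ?_
    have := hp2 p hp
    rw [hval p hp, sub_sub_cancel, inv_div, Real.exp_log (by positivity)]
  · have hM0 : (0 : ℝ) < M := by exact_mod_cast hM
    -- Rankin-type truncation: `r(n)/n ≤ r(n)/M` for the omitted `n`.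
    have htail : ∏ p ∈ Nat.primesBelow X, (1 - (r * natInvHom) p)⁻¹ ≤
        ∑ n ∈ Finset.Ico 1 (M + 1), r n / n + (∑' a, r a) / M := by
      have hfin : HasSum (fun n : ℕ ↦ if n ∈ Finset.Ico 1 (M + 1) then r n / n else 0)
          (∑ n ∈ Finset.Ico 1 (M + 1), r n / n) := by
        have := hasSum_sum_of_ne_finset_zero (L := SummationFilter.unconditional ℕ) (s := Finset.Ico 1 (M + 1))
          (f := fun n : ℕ ↦ if n ∈ Finset.Ico 1 (M + 1) then r n / n else 0)
          (fun b hb ↦ if_neg hb)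
        rwa [Finset.sum_ite_mem, Finset.inter_self] at this
      refine hasSum_le (fun n ↦ ?_) hsum2 (hfin.add (hsum.summable.hasSum.div_const (M : ℝ)))
      rw [hdiv_apply]
      have h0 : 0 ≤ r n / M := div_nonneg (hr0 n) hM0.le
      split_ifs with h
      · linarith
      · rw [zero_add]
        rcases eq_or_ne n 0 with rfl | hn
        · simp
        · have : M ≤ n := by
            by_contra hlt
            exact h (Finset.mem_Ico.2 ⟨Nat.one_le_iff_ne_zero.2 hn, by omega⟩)
          gcongr
          exact hr0 n
    -- Each factor satisfies `1 - 1/p + 1/X ≤ (1 - 1/p) e^(2/X)` because `1 - 1/p ≥ 1/2`. With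
    -- `O(X/log X)` primes the total loss is `e^(-2K/log X)`, which costs only `O(1)` from `log X`.
    have hprod : (∏ p ∈ Nat.primesBelow X, (1 - (p : ℝ)⁻¹)⁻¹) *
        Real.exp (-(2 * K / Real.log X)) ≤
        ∏ p ∈ Nat.primesBelow X, (1 - (r * natInvHom) p)⁻¹ := by
      have h1 : Real.exp (-(2 * K / Real.log X)) ≤
          ∏ p ∈ Nat.primesBelow X, Real.exp (-(2 / X)) := by
        rw [Finset.prod_const, ← Real.exp_nat_mul]
        refine Real.exp_le_exp.2 ?_
        have := mul_le_mul_of_nonneg_right hKX.2 (show 0 ≤ 2 / (X : ℝ) by positivity)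
        rw [show K * (X / Real.log X) * (2 / X) = 2 * K / Real.log X by field_simp] at this
        linarith
      have hpos : ∀ p ∈ Nat.primesBelow X, 0 < 1 - (p : ℝ)⁻¹ := fun p hp ↦ by
        have := inv_lt_one_of_one_lt₀ (by linarith [hp2 p hp] : (1 : ℝ) < p)
        linarith
      refine (mul_le_mul_of_nonneg_left h1 (Finset.prod_nonneg fun p hp ↦
        (inv_pos.2 (hpos p hp)).le)).trans ?_
      rw [← Finset.prod_mul_distrib]
      refine Finset.prod_le_prod (fun p hp ↦ mul_nonneg (inv_pos.2 (hpos p hp)).le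
        (Real.exp_pos _).le) fun p hp ↦ ?_
      have hp' := hp2 p hp
      have hinv : (p : ℝ)⁻¹ ≤ 1 / 2 := by rw [inv_eq_one_div]; gcongr
      have e : 1 - (r * natInvHom) p = 1 - (p : ℝ)⁻¹ + 1 / X := by
        rw [hdiv_apply, hval p hp]
        field_simp
        ring
      have hX1 : 0 < 1 / (X : ℝ) := by positivity
      rw [e, Real.exp_neg, ← mul_inv]
      refine inv_anti₀ (by linarith [hpos p hp]) ?_
      have h2 := Real.add_one_le_exp (2 / (X : ℝ))
      calc 1 - (p : ℝ)⁻¹ + 1 / X ≤ (1 - (p : ℝ)⁻¹) * (2 / X + 1) := by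
            rw [show (2 : ℝ) / X = 2 * (1 / X) by ring]
            nlinarith
        _ ≤ _ := by gcongr; exact (hpos p hp).le
    have hmain : Real.exp Real.eulerMascheroniConstant * (Real.log X - (C + 2 * K)) ≤
        (∏ p ∈ Nat.primesBelow X, (1 - (p : ℝ)⁻¹)⁻¹) * Real.exp (-(2 * K / Real.log X)) := by
      have h1 := Real.add_one_le_exp (-(2 * K / Real.log X))
      have h2 : Real.log X - (C + 2 * K) ≤
          (Real.log X - C) * Real.exp (-(2 * K / Real.log X)) := by
        refine le_trans ?_ (mul_le_mul_of_nonneg_left h1 (by linarith))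
        have : 0 ≤ C * (2 * K / Real.log X) := by positivity
        have e : Real.log X * (2 * K / Real.log X) = 2 * K := by field_simp
        nlinarith
      calc _ ≤ Real.exp Real.eulerMascheroniConstant *
            ((Real.log X - C) * Real.exp (-(2 * K / Real.log X))) := by gcongr
        _ = Real.exp Real.eulerMascheroniConstant * (Real.log X - C) *
            Real.exp (-(2 * K / Real.log X)) := by ring
        _ ≤ _ := by gcongr; exact hC X hX
    linarith

/-! ### From the resonance inequality to the measure of large values -/

theorem norm_sum_natCast_cpow_le (M : ℕ) (t : ℝ) :
    ‖∑ n ∈ Finset.Ico 1 (M + 1), (n : ℂ) ^ (-(1 + (t : ℂ) * Complex.I))‖ ≤ 1 + Real.log M := by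
  calc _ ≤ ∑ n ∈ Finset.Ico 1 (M + 1), (n : ℝ)⁻¹ := by
        refine norm_sum_le_of_le _ fun n hn ↦ ?_
        have hn0 : n ≠ 0 := by have := (Finset.mem_Ico.1 hn).1; omega
        rw [natCast_cpow_neg_one_add hn0, norm_ofReal_mul_exp_ofReal_mul_I, one_div,
          Real.norm_of_nonneg (by positivity)]
    _ = (harmonic M : ℝ) := by
        rw [harmonic, Finset.sum_Ico_eq_sum_range]
        push_cast
        simp [add_comm]
    _ ≤ _ := harmonic_le_one_add_log M

/-- In `V + 7`, the approximation of `ζ` uses `6`; the remaining `1` leaves one full copy of `∫ (1 -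
t/T)|R|² ≥ T/2` to be accounted for by the exceptional set. -/
theorem half_le_mul_measureReal_largeValues {r : ℕ →*₀ ℝ} (hr0 : ∀ a, 0 ≤ r a) (hr : Summable r)
    {T V : ℝ} (hT : 1 ≤ T) (hV : 0 ≤ V) {M : ℕ} (hTM : T ≤ M)
    (hD : V + 7 ≤ ∑ n ∈ Finset.Ico 1 (M + 1), r n / n) :
    T / 2 ≤ (∑' a, r a) ^ 2 * (1 + Real.log M) *
      (1 + volume.real {t ∈ Icc 1 T | V ≤ ‖riemannZeta (1 + (t : ℂ) * Complex.I)‖}) := by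
  set G := {t ∈ Icc 1 T | V ≤ ‖riemannZeta (1 + (t : ℂ) * Complex.I)‖} with hG
  have hT0 : 0 < T := by linarith
  have hGclosed : IsClosed G := by
    have hcont : ContinuousOn (fun t : ℝ ↦ ‖riemannZeta (1 + (t : ℂ) * Complex.I)‖) (Icc 1 T) := by
      intro t ht
      refine ContinuousAt.continuousWithinAt (ContinuousAt.norm ?_)
      have hne : (1 + (t : ℂ) * Complex.I) ≠ 1 := fun h ↦ by
        have := congrArg Complex.im h
        simp at this
        linarith [ht.1]
      exact (differentiableAt_riemannZeta hne).continuousAt.comp (f := fun t : ℝ ↦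
        (1 + (t : ℂ) * Complex.I)) (by fun_prop)
    exact hcont.preimage_isClosed_of_isClosed isClosed_Icc isClosed_Ici
  set R := ∑' a, r a with hR
  set B := 1 + Real.log M with hB
  have hB0 : 0 ≤ B := by
    have := Real.log_nonneg (hT.trans hTM)
    linarith
  -- The approximation of `ζ` is available only for `t ≥ 1`, so `[0, 1]` is counted as exceptional
  -- and contributes the `1` in `1 + |G|`.
  set E := Icc 0 1 ∪ G with hE
  have hEmeas : MeasurableSet E := measurableSet_Icc.union hGclosed.measurableSet
  set S : ℝ → ℂ := fun t ↦ ∑ n ∈ Finset.Ico 1 (M + 1), (n : ℂ) ^ (-(1 + (t : ℂ) * Complex.I))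
  set W : ℝ → ℝ := fun t ↦ Complex.normSq (resonator r t)
  have hWc : Continuous W :=
    Complex.continuous_normSq.comp (isPosTrigSeries_resonator hr0 hr).continuous
  have hW0 : ∀ t, 0 ≤ W t := fun t ↦ Complex.normSq_nonneg _
  have hWR : ∀ t, W t ≤ R ^ 2 := fun t ↦ by
    have := norm_resonator_le hr0 hr t
    simp only [W, Complex.normSq_eq_norm_sq]
    gcongr
  set I := ∫ t in (0 : ℝ)..T, (1 - t / T) * W t with hI
  have hIhalf : T / 2 ≤ I := half_le_integral_normSq_resonator hr0 hr hT0
  have hlow : (V + 7) * I ≤ ∫ t in (0 : ℝ)..T, (1 - t / T) * (W t * (S t).re) :=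
    (mul_le_mul_of_nonneg_right hD (by linarith)).trans
      (sum_mul_integral_le_integral_mul_re_sum hr0 hr hT0 M)
  have hind : IntervalIntegrable (E.indicator fun _ ↦ R ^ 2 * B) volume 0 T := by
    rw [intervalIntegrable_iff]
    exact (integrableOn_const (by simp)).indicator hEmeas
  have hupp : ∫ t in (0 : ℝ)..T, (1 - t / T) * (W t * (S t).re) ≤
      ∫ t in (0 : ℝ)..T, ((V + 6) * ((1 - t / T) * W t) +
        E.indicator (fun _ ↦ R ^ 2 * B) t) := by
    refine intervalIntegral.integral_mono_on hT0.le
      (intervalIntegrable_weight_mul (hWc.mul (Complex.continuous_re.comp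
        (continuous_sum_natCast_cpow M))) T)
      (((intervalIntegrable_weight_mul hWc T).const_mul _).add hind) fun t ht ↦ ?_
    have hw0 : 0 ≤ 1 - t / T := by rw [sub_nonneg, div_le_one hT0]; exact ht.2
    have hw1 : 1 - t / T ≤ 1 := by linarith [div_nonneg ht.1 hT0.le]
    have hSB : (S t).re ≤ B := (Complex.re_le_norm _).trans (norm_sum_natCast_cpow_le M t)
    by_cases htE : t ∈ E
    · rw [indicator_of_mem htE]
      have h1 : 0 ≤ (V + 6) * ((1 - t / T) * W t) :=
        mul_nonneg (by linarith) (mul_nonneg hw0 (hW0 t))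
      have h2 : (1 - t / T) * (W t * (S t).re) ≤ 1 * (R ^ 2 * B) := by
        calc _ ≤ (1 - t / T) * (W t * B) := by gcongr; exact hW0 t
          _ ≤ _ := by
            gcongr
            exacts [mul_nonneg (hW0 t) hB0, hWR t]
      linarith
    · rw [indicator_of_notMem htE, add_zero]
      have ht1 : 1 ≤ t := by
        by_contra h
        exact htE (Or.inl ⟨ht.1, (not_le.1 h).le⟩)
      have hζ : ‖riemannZeta (1 + (t : ℂ) * Complex.I)‖ < V := by
        by_contra h
        exact htE (Or.inr ⟨⟨ht1, ht.2⟩, not_lt.1 h⟩)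
      have h3 := norm_riemannZeta_one_add_sub_sum_le ht1 (ht.2.trans hTM)
      have h4 : (S t).re ≤ V + 6 := by
        refine (Complex.re_le_norm _).trans ?_
        have h5 := norm_sub_le (riemannZeta (1 + (t : ℂ) * Complex.I))
          (riemannZeta (1 + (t : ℂ) * Complex.I) - S t)
        rw [sub_sub_cancel] at h5
        exact h5.trans (add_le_add hζ.le h3)
      calc _ ≤ (1 - t / T) * (W t * (V + 6)) := by gcongr; exact hW0 t
        _ = _ := by ring
  rw [intervalIntegral.integral_add ((intervalIntegrable_weight_mul hWc T).const_mul _) hind,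
    intervalIntegral.integral_const_mul] at hupp
  have hEint : ∫ t in (0 : ℝ)..T, E.indicator (fun _ ↦ R ^ 2 * B) t ≤
      R ^ 2 * B * (1 + volume.real G) := by
    have hGfin : volume G ≠ ⊤ :=
      ((measure_mono (sep_subset _ _)).trans_lt measure_Icc_lt_top).ne
    have hEle : volume.real (E ∩ Ioc 0 T) ≤ 1 + volume.real G := by
      have hEfin : volume E ≠ ⊤ := measure_union_ne_top measure_Icc_lt_top.ne hGfin
      calc _ ≤ volume.real E := measureReal_mono inter_subset_left hEfin
        _ ≤ volume.real (Icc (0 : ℝ) 1) + volume.real G := measureReal_union_le _ _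
        _ = _ := by simp
    rw [intervalIntegral.integral_of_le hT0.le, integral_indicator_const _ hEmeas,
      measureReal_restrict_apply hEmeas, smul_eq_mul, mul_comm]
    exact mul_le_mul_of_nonneg_left hEle (by positivity)
  linarith

/-! ### Choice of parameters and conclusion -/

theorem eventually_four_mul_le_exp_rpow {η : ℝ} (hη : 0 < η) :
    ∀ᶠ x : ℝ in atTop, 4 * (2 + x) ≤ Real.exp (3 / 4 * x ^ η) := by
  have h := (isLittleO_log_rpow_atTop hη).bound (show (0 : ℝ) < 1 / 4 by norm_num)
  filter_upwards [h, eventually_ge_atTop 4] with x hx hx4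
  rw [Real.norm_of_nonneg (Real.log_nonneg (by linarith)), Real.norm_of_nonneg (by positivity)] at hx
  calc 4 * (2 + x) ≤ x ^ 3 := by nlinarith [mul_self_nonneg (x - 4)]
    _ = Real.exp (3 * Real.log x) := by
        rw [mul_comm, Real.exp_mul, Real.exp_log (by linarith)]; norm_cast
    _ ≤ _ := Real.exp_le_exp.2 (by linarith)

/-- With `L = log T`, the resonator uses a quarter of the allowed loss `L/A` in the exponent. The
other three quarters absorb the factor `2 + L`, and the summand `1` is absorbed because `e^(L - L/A)
≥ 1`. -/
theorem exp_sub_div_le_of_half_exp_le {L A g : ℝ} (hL : 0 ≤ L) (hA : 1 ≤ A)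
    (hLA : 4 * (2 + L) ≤ Real.exp (3 / 4 * (L / A)))
    (h : Real.exp L / 2 ≤ Real.exp (L / (4 * A)) * (2 + L) * (1 + g)) :
    Real.exp (L - L / A) ≤ g := by
  have hsplit : Real.exp L =
      Real.exp (L / (4 * A)) * Real.exp (L - L / A) * Real.exp (3 / 4 * (L / A)) := by
    rw [← Real.exp_add, ← Real.exp_add]
    congr 1
    field_simp
    ring
  have hone : 1 ≤ Real.exp (L - L / A) :=
    Real.one_le_exp (by linarith [div_le_self hL hA])
  set a := Real.exp (L / (4 * A))
  set e := Real.exp (L - L / A)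
  have ha0 : 0 < a := Real.exp_pos _
  have h1 : a * e * (4 * (2 + L)) ≤ 2 * (a * (2 + L) * (1 + g)) := by
    calc _ ≤ a * e * Real.exp (3 / 4 * (L / A)) := by gcongr
      _ = Real.exp L := hsplit.symm
      _ ≤ _ := by linarith
  have h2 : (2 * a * (2 + L)) * (2 * e) ≤ (2 * a * (2 + L)) * (1 + g) := by linarith
  linarith [le_of_mul_le_mul_left h2 (by positivity)]

theorem theorem2 (θ : ℝ) (hθ : θ < 1) :
    ∃ C T₀ : ℝ, ∀ T : ℝ, T₀ ≤ T → ∀ A : ℝ, 10 ≤ A → A ≤ Real.log T ^ θ →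
      ENNReal.ofReal (T ^ (1 - 1 / A)) ≤ MeasureTheory.volume (largeZetaSet T A C) := by
  obtain ⟨K, C, hK, hres⟩ := exists_resonator_coefficients
  obtain ⟨X₀, hX₀⟩ := eventually_atTop.1 hres
  obtain ⟨b, hθb, hb0, hb1⟩ : ∃ b, θ ≤ b ∧ 0 < b ∧ b < 1 :=
    ⟨max θ (1 / 2), le_max_left _ _, lt_max_of_lt_right (by norm_num), max_lt hθ (by norm_num)⟩
  set η := 1 - b with hη_def
  have hη : 0 < η := by linarith
  -- Chosen so that `K Y / ((η/2) log L) = L/(8A)` for `Y = c (L/A) log L`, which yields `R(0)² ≤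
  -- e^(L/(4A))`.
  set c := η / (16 * K) with hc_def
  have hc : 0 < c := by positivity
  have hlog := Real.tendsto_log_atTop
  have hev : ∀ᶠ L : ℝ in atTop, 1 ≤ L ∧ 4 / c ≤ Real.log L ∧ (X₀ : ℝ) + 1 ≤ L ^ η ∧
      C + 8 ≤ η / 2 * Real.log L ∧ 1 ≤ Real.log (Real.log L) ∧
      4 * (2 + L) ≤ Real.exp (3 / 4 * L ^ η) := by
    filter_upwards [eventually_ge_atTop 1, hlog.eventually_ge_atTop (4 / c),
      (tendsto_rpow_atTop hη).eventually_ge_atTop ((X₀ : ℝ) + 1),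
      (hlog.const_mul_atTop (half_pos hη)).eventually_ge_atTop (C + 8),
      (hlog.comp hlog).eventually_ge_atTop 1, eventually_four_mul_le_exp_rpow hη]
      with L h1 h2 h3 h4 h5 h6 using ⟨h1, h2, h3, h4, h5, h6⟩
  obtain ⟨T₀, hT₀⟩ := eventually_atTop.1 ((hlog.eventually hev).and (eventually_ge_atTop 1))
  -- `C` is the loss in the Mertens product, `log (c/2)` comes from `X ≥ Y/2`, and `8` is the
  -- required margin `7` plus `1` for the truncation term `R(0)/M`; the factor `e^γ ≥ 1` only helps.
  refine ⟨C - Real.log (c / 2) + 8, T₀, fun T hT A hA hAT ↦ ?_⟩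
  obtain ⟨⟨hL1, hL2, hL3, hL4, hL5, hL6⟩, hT1⟩ := hT₀ T hT
  have hT0 : 0 < T := by linarith
  set L := Real.log T with hL
  have hTL : T = Real.exp L := (Real.exp_log hT0).symm
  have hL0 : 0 < L := by linarith
  have hA0 : 0 < A := by linarith
  have hlL : 0 < Real.log L := lt_of_lt_of_le (by positivity) hL2
  have hAb : A ≤ L ^ b := hAT.trans (Real.rpow_le_rpow_of_exponent_le hL1 hθb)
  -- The bound on `A` leaves a power of `log T` in `L/A`; this gives `log X ≥ (η/2) log L` uniformly
  -- in `A`.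
  have hLA : L ^ η ≤ L / A := by
    rw [le_div_iff₀ hA0]
    calc L ^ η * A ≤ L ^ η * L ^ b := by gcongr
      _ = L := by rw [← Real.rpow_add hL0, hη_def, sub_add_cancel, Real.rpow_one]
  have hη2 : L ^ (η / 2) ≤ L ^ η := Real.rpow_le_rpow_of_exponent_le hL1 (by linarith)
  set Y := c * (L / A) * Real.log L with hY
  have hY4 : 4 * L ^ η ≤ Y := by
    have h1 : 4 ≤ c * Real.log L := by rw [div_le_iff₀ hc] at hL2; linarith
    have h2 : 0 ≤ L / A := by positivity
    rw [hY]
    nlinarith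
  have hLη1 : 1 ≤ L ^ η := Real.one_le_rpow hL1 hη.le
  set X := ⌊Y⌋₊ with hX
  have hY0 : 0 ≤ Y := by linarith
  have hXY : (X : ℝ) ≤ Y := Nat.floor_le hY0
  have hXY2 : Y / 2 ≤ X := by
    have := Nat.lt_floor_add_one Y
    linarith
  have hXX₀ : X₀ ≤ X := by
    have : (X₀ : ℝ) ≤ X := by linarith
    exact_mod_cast this
  have hXη : L ^ (η / 2) ≤ X := by linarith
  obtain ⟨r, hr0, hr, hR, hsum⟩ := hX₀ X hXX₀
  have hlogX : η / 2 * Real.log L ≤ Real.log X := by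
    rw [← Real.log_rpow hL0]
    exact Real.log_le_log (by positivity) hXη
  have hlogX2 : Real.log (c / 2) + Real.log L + Real.log (Real.log L) - Real.log A ≤
      Real.log X := by
    have : Real.log (Y / 2) = Real.log (c / 2) + Real.log L + Real.log (Real.log L) -
        Real.log A := by
      rw [show Y / 2 = c / 2 * L * Real.log L / A by rw [hY]; ring,
        Real.log_div (by positivity) hA0.ne', Real.log_mul (by positivity) hlL.ne',
        Real.log_mul (by positivity) hL0.ne']
    rw [← this]
    exact Real.log_le_log (by linarith) hXY2
  have hR2 : ∑' a, r a ≤ Real.exp (L / (8 * A)) := by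
    refine hR.trans (Real.exp_le_exp.2 ?_)
    have hden : 0 < η / 2 * Real.log L := by positivity
    calc K * (X / Real.log X) ≤ K * (Y / (η / 2 * Real.log L)) := by gcongr
      _ = L / (8 * A) := by rw [hY, hc_def]; field_simp; norm_num
  have hR0 : 0 ≤ ∑' a, r a := tsum_nonneg hr0
  set M := ⌈T⌉₊ with hM
  have hTM : T ≤ M := Nat.le_ceil T
  have hM1 : (1 : ℝ) ≤ M := hT1.trans hTM
  have hlogM : Real.log M ≤ 1 + L := by
    have h1 : (M : ℝ) ≤ Real.exp (1 + L) := by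
      have h2 := Nat.ceil_lt_add_one hT0.le
      rw [Real.exp_add, ← hTL]
      nlinarith [Real.add_one_le_exp 1]
    rw [Real.log_le_iff_le_exp (by linarith)]
    exact h1
  have hRM : (∑' a, r a) / M ≤ 1 := by
    rw [div_le_one (by linarith)]
    refine hR2.trans (le_trans ?_ hTM)
    rw [hTL]
    refine Real.exp_le_exp.2 (div_le_self hL0.le (by linarith))
  have hγ : 1 ≤ Real.exp Real.eulerMascheroniConstant :=
    Real.one_le_exp (by linarith [Real.one_half_lt_eulerMascheroniConstant])
  have hi2 : iterLog 2 T = Real.log L := rfl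
  have hi3 : iterLog 3 T = Real.log (Real.log L) := rfl
  have hi4 : 0 ≤ iterLog 4 T := Real.log_nonneg hL5
  set V₀ := Real.exp Real.eulerMascheroniConstant *
    (iterLog 2 T + iterLog 3 T - iterLog 4 T - Real.log A - (C - Real.log (c / 2) + 8)) with hV₀
  -- The resonance inequality needs a nonnegative threshold, hence the maximum; the case `0` uses
  -- only that `log X` is large.
  have hD : max V₀ 0 + 7 ≤ ∑ n ∈ Finset.Ico 1 (M + 1), r n / n := by
    refine le_trans ?_ (hsum M (by exact_mod_cast hM1))
    have h1 : V₀ + 8 ≤ Real.exp Real.eulerMascheroniConstant * (Real.log X - C) := by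
      calc V₀ + 8 ≤ V₀ + Real.exp Real.eulerMascheroniConstant * 8 := by linarith
        _ = Real.exp Real.eulerMascheroniConstant * (iterLog 2 T + iterLog 3 T - iterLog 4 T -
            Real.log A - C + Real.log (c / 2)) := by rw [hV₀]; ring
        _ ≤ _ := by
          gcongr
          rw [hi2, hi3]
          linarith
    have h2 : 8 ≤ Real.exp Real.eulerMascheroniConstant * (Real.log X - C) :=
      le_trans (by linarith only [hL4, hlogX]) (le_mul_of_one_le_left (by linarith only [hL4, hlogX]) hγ)
    rcases max_choice V₀ 0 with h | h <;> rw [h] <;> linarith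
  have hkey := half_le_mul_measureReal_largeValues hr0 hr hT1 (le_max_right V₀ 0) hTM hD
  set G := {t ∈ Icc 1 T | max V₀ 0 ≤ ‖riemannZeta (1 + (t : ℂ) * Complex.I)‖} with hG
  have hGsub : G ⊆ largeZetaSet T A (C - Real.log (c / 2) + 8) := fun t ht ↦
    ⟨⟨zero_le_one.trans ht.1.1, ht.1.2⟩, (le_max_left _ _).trans ht.2⟩
  have hvol : T ^ (1 - 1 / A) ≤ volume.real G := by
    have h1 : T / 2 ≤ Real.exp (L / (4 * A)) * (2 + L) * (1 + volume.real G) := by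
      refine hkey.trans ?_
      have : (∑' a, r a) ^ 2 ≤ Real.exp (L / (4 * A)) := by
        calc (∑' a, r a) ^ 2 ≤ Real.exp (L / (8 * A)) ^ 2 := by gcongr
          _ = _ := by rw [← Real.exp_nat_mul]; congr 1; push_cast; field_simp; norm_num
      have h0 : 0 ≤ 1 + Real.log M := by linarith [Real.log_nonneg hM1]
      gcongr ?_ * ?_ * _
      linarith only [hlogM]
    have h2 : T ^ (1 - 1 / A) = Real.exp (L - L / A) := by
      rw [Real.rpow_def_of_pos hT0]
      congr 1
      ring
    have h3 : 4 * (2 + L) ≤ Real.exp (3 / 4 * (L / A)) :=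
      hL6.trans (Real.exp_le_exp.2 (by linarith))
    rw [h2]
    rw [hTL] at h1
    exact exp_sub_div_le_of_half_exp_le hL0.le (by linarith only [hA]) h3 h1
  have hGfin : volume G ≠ ⊤ :=
    ((measure_mono (sep_subset _ _)).trans_lt measure_Icc_lt_top).ne
  calc ENNReal.ofReal (T ^ (1 - 1 / A)) ≤ ENNReal.ofReal (volume.real G) :=
        ENNReal.ofReal_le_ofReal hvol
    _ = volume G := ENNReal.ofReal_toReal hGfin
    _ ≤ _ := measure_mono hGsub
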